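/- Let $\mathbb K=\mathbb R$ or $\mathbb C$, $D\ge 0$, and let $f:\mathbb K^D\times\mathbb K^D\times\mathbb R\to\mathbb K^D$, $(x,y,\theta)\mapsto f(x,y,\theta)$, be smooth ($C^\infty$ jointly in all variables), holomorphic in $(x,y)$ if $\mathbb K=\mathbb C$, and $2\pi$-periodic in $\theta$, with Fourier coefficients $$f_k(x,y)=\frac1{2\pi}\int_0^{2\pi}e^{-ik\theta}f(x,y,\theta)\,d\theta\in\mathbb C^D,\qquad k\in\mathbb Z .$$ Denote by $\partial_xf_k$, $\partial_yf_k$ the $D\times D$ Jacobian matrices of $f_k$ with respect to $x$ and $y$. Let $\tau>0$ and let $\varphi:[-\tau,0]\to\mathbb K^D$ be smooth and independent of $\Omega$. For $\Omega>0$ consider the oscillatory delay problem $$x'(t)=f(x(t),x(t-\tau),\Omega t)\quad(t\ge 0),\qquad x(t)=\varphi(t)\quad(-\tau\le t\le 0),\tag{1}$$ and the averaged delay problem, with $X$ continuous, $$X'(t)=F_{2,1}\quad(0\le t<\tau),\qquad X'(t)=F_{2,2}\quad(t\ge\tau),\qquad X(t)=\varphi(t)\quad(-\tau\le t\le0),\tag{2}$$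 (the derivative at $t=0$ and at $t=\tau$ being the one from the right) where, with $x=X(t)$, $y=X(t-\tau)$, $z=X(t-2\tau)$, $$F_{2,1}=f_0(x,y)+\sum_{k\ne0}\frac{i}{k\Omega}\partial_xf_0(x,y)f_k(x,y)-\sum_{k\ne0}\frac{i}{k\Omega}\partial_xf_k(x,y)f_0(x,y)+\sum_{k\ne0}\frac{i}{k\Omega}\partial_xf_k(x,y)f_{-k}(x,y)-\sum_{k\ne0}\frac{i}{k\Omega}\partial_yf_k(x,y)\,\varphi'(t-\tau),$$ $$\begin{aligned}F_{2,2}={}&f_0(x,y)+\sum_{k\ne0}\frac{i}{k\Omega}\partial_xf_0(x,y)f_k(x,y)-\sum_{k\ne0}\frac{i}{k\Omega}\partial_xf_k(x,y)f_0(x,y)+\sum_{k\ne0}\frac{i}{k\Omega}\partial_xf_k(x,y)f_{-k}(x,y)\\&+\sum_{k\ne0}\frac{i}{k\Omega}\partial_yf_0(x,y)f_k(y,z)-\sum_{k\ne0}\frac{i}{k\Omega}\partial_yf_k(x,y)f_0(y,z)+\sum_{k\ne0}\frac{i}{k\Omega}\partial_yf_k(x,y)f_{-k}(y,z).\end{aligned}$$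 Then all the series in $F_{2,1}$ and $F_{2,2}$ converge absolutely (for all $x,y,z\in\mathbb K^D$, and with any vector of $\mathbb K^D$ in place of $\varphi'(t-\tau)$), and the solutions of (1) and (2) agree up to $\mathcal O(1/\Omega^2)$ at stroboscopic times: for every $T\ge0$ and every $R$ there are constants $C$ and $\Omega_0>0$ such that the following holds for every $\Omega\ge\Omega_0$ for which $\tau$ is an integer multiple of the period $2\pi/\Omega$. If $x$ and $X$ are solutions of (1) and (2) on $[-\tau,T]$, and at least one of them is bounded in norm by $R$ on $[0,T]$, then $$\|x(t)-X(t)\|\le \frac{C}{\Omega^2}\qquad\text{for all } t=m\,\frac{2\pi}{\Omega}\in[0,T],\quad m=0,1,2,\dots$$ -/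

import Mathlib

open Set MeasureTheory Matrix
open scoped ContDiff

namespace DelayAveraging

noncomputable section

/-- Coordinatewise inclusion `𝕜 ^ D → ℂ ^ D`. It is used with `𝕜 = ℝ` (the usual inclusion)
and with `𝕜 = ℂ` (the identity). -/
def toC {𝕜 : Type*} [RCLike 𝕜] [NormedAlgebra 𝕜 ℂ] {D : ℕ} (v : Fin D → 𝕜) : Fin D → ℂ :=
  fun i => algebraMap 𝕜 ℂ (v i)

/-- The Fourier coefficient `f_k(x, y) = (2π)⁻¹ ∫₀^{2π} exp(-ikθ) f(x, y, θ) dθ ∈ ℂ ^ D` of the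
`2π`-periodic function `θ ↦ f(x, y, θ)`. -/
def fourierCo {𝕜 : Type*} [RCLike 𝕜] [NormedAlgebra 𝕜 ℂ] {D : ℕ}
    (f : (Fin D → 𝕜) → (Fin D → 𝕜) → ℝ → (Fin D → 𝕜)) (k : ℤ)
    (x y : Fin D → 𝕜) : Fin D → ℂ :=
  fourierCoeffOn Real.two_pi_pos (fun θ : ℝ => toC (f x y θ)) k

/-- The `D × D` Jacobian matrix `(∂ g_i / ∂ x_j)` of a map `g : 𝕜 ^ D → ℂ ^ D`. -/
def jacobian {𝕜 : Type*} [RCLike 𝕜] [NormedAlgebra 𝕜 ℂ] {D : ℕ}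
    (g : (Fin D → 𝕜) → (Fin D → ℂ)) (x : Fin D → 𝕜) : Matrix (Fin D) (Fin D) ℂ :=
  Matrix.of fun i j => fderiv 𝕜 g x (Pi.single j 1) i

/-- `∂ₓ f_k (x, y)`, the Jacobian matrix with respect to the first argument. -/
def jacX {𝕜 : Type*} [RCLike 𝕜] [NormedAlgebra 𝕜 ℂ] {D : ℕ}
    (f : (Fin D → 𝕜) → (Fin D → 𝕜) → ℝ → (Fin D → 𝕜)) (k : ℤ)
    (x y : Fin D → 𝕜) : Matrix (Fin D) (Fin D) ℂ :=
  jacobian (fun x' => fourierCo f k x' y) x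

/-- `∂_y f_k (x, y)`, the Jacobian matrix with respect to the second argument. -/
def jacY {𝕜 : Type*} [RCLike 𝕜] [NormedAlgebra 𝕜 ℂ] {D : ℕ}
    (f : (Fin D → 𝕜) → (Fin D → 𝕜) → ℝ → (Fin D → 𝕜)) (k : ℤ)
    (x y : Fin D → 𝕜) : Matrix (Fin D) (Fin D) ℂ :=
  jacobian (fun y' => fourierCo f k x y') y

/-- The terms `(i / (k Ω)) a_k`, for `k ≠ 0`. -/
def oscTerm {D : ℕ} (Ω : ℝ) (a : ℤ → (Fin D → ℂ)) (k : {k : ℤ // k ≠ 0}) : Fin D → ℂ :=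
  (Complex.I / (((k : ℤ) : ℂ) * (Ω : ℂ))) • a k

/-- The series `∑_{k ≠ 0} (i / (k Ω)) a_k`. -/
def oscSum {D : ℕ} (Ω : ℝ) (a : ℤ → (Fin D → ℂ)) : Fin D → ℂ :=
  ∑' k : {k : ℤ // k ≠ 0}, oscTerm Ω a k

/-- The right-hand side `F_{2,1}` on `0 ≤ t < τ`, with `x = X(t)`, `y = X(t - τ)` and
`v = φ'(t - τ)`. -/
def F21 {𝕜 : Type*} [RCLike 𝕜] [NormedAlgebra 𝕜 ℂ] {D : ℕ}
    (f : (Fin D → 𝕜) → (Fin D → 𝕜) → ℝ → (Fin D → 𝕜)) (Ω : ℝ)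
    (x y v : Fin D → 𝕜) : Fin D → ℂ :=
  fourierCo f 0 x y
    + oscSum Ω (fun k => jacX f 0 x y *ᵥ fourierCo f k x y)
    - oscSum Ω (fun k => jacX f k x y *ᵥ fourierCo f 0 x y)
    + oscSum Ω (fun k => jacX f k x y *ᵥ fourierCo f (-k) x y)
    - oscSum Ω (fun k => jacY f k x y *ᵥ toC v)

/-- The right-hand side `F_{2,2}` on `t ≥ τ`, with `x = X(t)`, `y = X(t - τ)` and
`z = X(t - 2τ)`. -/
def F22 {𝕜 : Type*} [RCLike 𝕜] [NormedAlgebra 𝕜 ℂ] {D : ℕ}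
    (f : (Fin D → 𝕜) → (Fin D → 𝕜) → ℝ → (Fin D → 𝕜)) (Ω : ℝ)
    (x y z : Fin D → 𝕜) : Fin D → ℂ :=
  fourierCo f 0 x y
    + oscSum Ω (fun k => jacX f 0 x y *ᵥ fourierCo f k x y)
    - oscSum Ω (fun k => jacX f k x y *ᵥ fourierCo f 0 x y)
    + oscSum Ω (fun k => jacX f k x y *ᵥ fourierCo f (-k) x y)
    + oscSum Ω (fun k => jacY f 0 x y *ᵥ fourierCo f k y z)
    - oscSum Ω (fun k => jacY f k x y *ᵥ fourierCo f 0 y z)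
    + oscSum Ω (fun k => jacY f k x y *ᵥ fourierCo f (-k) y z)

/-- All the series that occur in `F21` and `F22` converge. -/
def SeriesConverge {𝕜 : Type*} [RCLike 𝕜] [NormedAlgebra 𝕜 ℂ] {D : ℕ}
    (f : (Fin D → 𝕜) → (Fin D → 𝕜) → ℝ → (Fin D → 𝕜)) (Ω : ℝ)
    (x y z v : Fin D → 𝕜) : Prop :=
  Summable (oscTerm Ω fun k => jacX f 0 x y *ᵥ fourierCo f k x y) ∧
  Summable (oscTerm Ω fun k => jacX f k x y *ᵥ fourierCo f 0 x y) ∧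
  Summable (oscTerm Ω fun k => jacX f k x y *ᵥ fourierCo f (-k) x y) ∧
  Summable (oscTerm Ω fun k => jacY f k x y *ᵥ toC v) ∧
  Summable (oscTerm Ω fun k => jacY f 0 x y *ᵥ fourierCo f k y z) ∧
  Summable (oscTerm Ω fun k => jacY f k x y *ᵥ fourierCo f 0 y z) ∧
  Summable (oscTerm Ω fun k => jacY f k x y *ᵥ fourierCo f (-k) y z)

/-- `x` solves `x'(t) = f(x(t), x(t - τ), Ω t)` on `[0, T]` with history `φ` on `[-τ, 0]`
(one-sided derivatives at the end points `0` and `T`). -/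
structure IsOscSolution {𝕜 : Type*} [RCLike 𝕜] {D : ℕ}
    (f : (Fin D → 𝕜) → (Fin D → 𝕜) → ℝ → (Fin D → 𝕜)) (φ : ℝ → (Fin D → 𝕜))
    (τ Ω T : ℝ) (x : ℝ → (Fin D → 𝕜)) : Prop where
  history : ∀ t ∈ Icc (-τ) 0, x t = φ t
  eqn : ∀ t ∈ Icc 0 T,
    HasDerivWithinAt x (f (x t) (x (t - τ)) (Ω * t)) (Icc 0 T) t

/-- `X` is a continuous solution on `[-τ, T]`, with history `φ` on `[-τ, 0]`, of the averaged
equation `X' = F21` for `0 ≤ t < τ`, `X' = F22` for `τ ≤ t`. The right-hand side may jump at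
`t = τ`, so that the derivative there is the one from the right. The identities are written in
`ℂ ^ D`, where `F21` and `F22` take their values. -/
structure IsAvgSolution {𝕜 : Type*} [RCLike 𝕜] [NormedAlgebra 𝕜 ℂ] {D : ℕ}
    (f : (Fin D → 𝕜) → (Fin D → 𝕜) → ℝ → (Fin D → 𝕜)) (φ : ℝ → (Fin D → 𝕜))
    (τ Ω T : ℝ) (X : ℝ → (Fin D → 𝕜)) : Prop where
  history : ∀ t ∈ Icc (-τ) 0, X t = φ t
  continuousOn : ContinuousOn X (Icc (-τ) T)
  eqn₁ : ∀ t ∈ Icc 0 T, t < τ →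
    HasDerivWithinAt (fun s => toC (X s))
      (F21 f Ω (X t) (X (t - τ)) (derivWithin φ (Icc (-τ) 0) (t - τ))) (Icc 0 T) t
  eqn₂ : ∀ t ∈ Icc τ T,
    HasDerivWithinAt (fun s => toC (X s))
      (F22 f Ω (X t) (X (t - τ)) (X (t - 2 * τ))) (Icc τ T) t

end

end DelayAveraging

/-! Let `u = oscPrim F` be the primitive in θ of F minus its θ-mean f₀, normalised by u = 0 at θ =
0. It is 2π-periodic, so w(t) = X(t) + Ω⁻¹ u(X(t), X(t-τ), Ωt) equals X at stroboscopic times, and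
it suffices to prove x - w = O(Ω⁻²) on the whole interval.

In w' the angular derivative of Ω⁻¹u replaces the leading term f₀ of X' by F. Compare with F
evaluated at w and its delayed value, and expand by Taylor: the terms of order Ω⁻¹ are, up to sign,
`residual`, that is ∂F·(u, b) - ∂u·(f₀, c), minus the first-order term of X'. Here b is the
oscillation of the delayed argument and c its velocity to leading order: b = 0, c = φ' while the
delay reaches into the history, then b = u(y, z, θ), c = f₀(y, z). The latter uses that Ωτ is a
multiple of 2π, so that the angle is the same at t and t - τ. Taking the mean of `residual` as
first-order term of the averaged equation leaves a mean-zero oscillation of size Ω⁻¹, whose time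
integral is O(Ω⁻²) (`norm_integral_oscillating_le`), plus a rest of size Ω⁻²
(`exists_defect_bound`). Grönwall's inequality turns this into x - w = O(Ω⁻²) as long as both
solutions stay bounded (`exists_error_bound`), and a continuity argument (`le_of_bootstrap`) derives
a bound on both from a bound on one.

It remains to recognise the means as the given series. Integration divides the k-th Fourier
coefficient by ik; evaluating the Fourier series of u at θ = 0, where u vanishes, gives mean(u) = ∑
(i/k) f_k, and Parseval's formula gives the means of products. Hence the averaged fields are exactly
the given right-hand sides (`F21_eq`, `F22_eq`). -/

namespace DelayAveraging

open Filter Topology Metric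

set_option linter.unusedSectionVars false

noncomputable section

/-! ### Means and oscillatory primitives depending on a parameter, with bounds uniform in the angle
-/

section Calculus

variable {P G : Type*} [NormedAddCommGroup P] [NormedSpace ℝ P] [NormedAddCommGroup G]
  [NormedSpace ℝ G]

/-- The derivative of `F (p, θ)` with respect to `p`. -/
def partialFDeriv (F : P × ℝ → G) (q : P × ℝ) : P →L[ℝ] G :=
  fderiv ℝ (fun p => F (p, q.2)) q.1

theorem hasFDerivAt_partial {F : P × ℝ → G} (hF : ContDiff ℝ 1 F) (p : P) (θ : ℝ) :
    HasFDerivAt (fun p => F (p, θ)) (partialFDeriv F (p, θ)) p := by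
  have h : Differentiable ℝ fun p => F (p, θ) :=
    (hF.comp (contDiff_prodMk_left θ)).differentiable one_ne_zero
  exact (h p).hasFDerivAt

theorem partialFDeriv_eq {F : P × ℝ → G} (hF : ContDiff ℝ 1 F) :
    partialFDeriv F = fun q => (fderiv ℝ F q).comp (ContinuousLinearMap.inl ℝ P ℝ) := by
  funext ⟨p, θ⟩
  have h := ((hF.differentiable one_ne_zero) (p, θ)).hasFDerivAt.comp p
    (hasFDerivAt_prodMk_left (𝕜 := ℝ) p θ)
  exact h.fderiv

theorem contDiff_partialFDeriv {F : P × ℝ → G} {m n : WithTop ℕ∞} (hF : ContDiff ℝ n F)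
    (hmn : m + 1 ≤ n) : ContDiff ℝ m (partialFDeriv F) := by
  rw [partialFDeriv_eq (hF.of_le (le_trans le_add_self hmn))]
  exact (hF.fderiv_right hmn).clm_comp contDiff_const

theorem exists_bound_of_continuous [ProperSpace P] {h : P × ℝ → G} (hc : Continuous h)
    (M a b : ℝ) : ∃ B, 0 ≤ B ∧ ∀ p, ‖p‖ ≤ M → ∀ θ ∈ Icc a b, ‖h (p, θ)‖ ≤ B := by
  obtain ⟨B, hB⟩ := ((isCompact_closedBall (0 : P) M).prod (isCompact_Icc (a := a) (b := b))
    ).exists_bound_of_continuousOn hc.continuousOn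
  refine ⟨max B 0, le_max_right _ _, fun p hp θ hθ => (hB (p, θ) ⟨?_, hθ⟩).trans (le_max_left _ _)⟩
  simpa using hp

theorem hasFDerivAt_parametric_integral [ProperSpace P] [CompleteSpace G] {F : P × ℝ → G}
    (hF : ContDiff ℝ 1 F) (a b : ℝ) (p : P) :
    HasFDerivAt (fun p => ∫ s in a..b, F (p, s)) (∫ s in a..b, partialFDeriv F (p, s)) p := by
  have hF' : Continuous (partialFDeriv F) :=
    (contDiff_partialFDeriv (m := 0) hF (by simp)).continuous
  obtain ⟨B, -, hB⟩ := exists_bound_of_continuous hF' (‖p‖ + 1) (min a b) (max a b)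
  refine (intervalIntegral.hasFDerivAt_integral_of_dominated_of_fderiv_le
    (F := fun p s => F (p, s)) (F' := fun p s => partialFDeriv F (p, s)) (bound := fun _ => B)
    (ball_mem_nhds p one_pos) ?_ ?_ ?_ ?_ ?_ ?_)
  · exact Eventually.of_forall fun x =>
      (hF.continuous.comp (Continuous.prodMk_right x)).aestronglyMeasurable
  · exact (hF.continuous.comp (Continuous.prodMk_right p)).intervalIntegrable _ _
  · exact (hF'.comp (Continuous.prodMk_right p)).aestronglyMeasurable
  · refine Eventually.of_forall fun t ht x hx => hB x ?_ t (uIoc_subset_uIcc ht)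
    have := norm_sub_norm_le x p
    rw [mem_ball, dist_eq_norm] at hx
    linarith
  · exact intervalIntegrable_const
  · exact Eventually.of_forall fun t _ x _ => hasFDerivAt_partial hF x t

theorem contDiff_parametric_integral [ProperSpace P] [CompleteSpace G] {F : P × ℝ → G}
    (hF : ContDiff ℝ 1 F) (a b : ℝ) :
    ContDiff ℝ 1 (fun p => ∫ s in a..b, F (p, s)) := by
  have hF' : Continuous (partialFDeriv F) :=
    (contDiff_partialFDeriv (m := 0) hF (by simp)).continuous
  rw [contDiff_one_iff_fderiv]
  refine ⟨fun p => (hasFDerivAt_parametric_integral hF a b p).differentiableAt, ?_⟩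
  have : (fderiv ℝ fun p => ∫ s in a..b, F (p, s)) =
      fun p => ∫ s in a..b, partialFDeriv F (p, s) :=
    funext fun p => (hasFDerivAt_parametric_integral hF a b p).fderiv
  rw [this]
  exact intervalIntegral.continuous_parametric_intervalIntegral_of_continuous' (μ := volume)
    (f := fun p s => partialFDeriv F (p, s)) hF' a b

/-- The mean of a `2π`-periodic function. -/
def periodMean (g : ℝ → G) : G := (2 * Real.pi)⁻¹ • ∫ θ in 0..(2 * Real.pi), g θ

/-- The mean of `F (p, θ)` with respect to `θ`. -/
def avg (F : P × ℝ → G) (p : P) : G := periodMean fun θ => F (p, θ)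

/-- The primitive of the oscillatory part of `F` that vanishes at `θ = 0`. -/
def oscPrim (F : P × ℝ → G) (q : P × ℝ) : G := ∫ s in 0..q.2, (F (q.1, s) - avg F q.1)

/-- `2π`-periodicity in the second variable. -/
def PeriodicInAngle (F : P × ℝ → G) : Prop := ∀ p, Function.Periodic (fun θ => F (p, θ)) (2 * Real.pi)

theorem contDiff_avg [ProperSpace P] [CompleteSpace G] {F : P × ℝ → G} (hF : ContDiff ℝ 1 F) :
    ContDiff ℝ 1 (avg F) :=
  (contDiff_parametric_integral hF _ _).const_smul _

theorem hasFDerivAt_avg [ProperSpace P] [CompleteSpace G] {F : P × ℝ → G}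
    (hF : ContDiff ℝ 1 F) (p : P) : HasFDerivAt (avg F) (avg (partialFDeriv F) p) p :=
  (hasFDerivAt_parametric_integral hF _ _ p).const_smul _

theorem contDiff_oscPrim [ProperSpace P] [CompleteSpace G] {F : P × ℝ → G}
    (hF : ContDiff ℝ 1 F) : ContDiff ℝ 1 (oscPrim F) := by
  -- Rescaling the integration variable by θ makes the endpoints constant, so θ becomes a parameter
  -- like p and joint smoothness follows from the fixed-interval case.
  have h : oscPrim F = fun q : P × ℝ => q.2 • ∫ s in (0 : ℝ)..1,
      (fun z : (P × ℝ) × ℝ => F (z.1.1, z.1.2 * z.2) - avg F z.1.1) (q, s) := by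
    funext q
    have := intervalIntegral.smul_integral_comp_mul_left (a := 0) (b := 1)
      (fun s => F (q.1, s) - avg F q.1) q.2
    simp only [mul_zero, mul_one] at this
    exact this.symm
  rw [h]
  have hd : ContDiff ℝ 1 fun z : (P × ℝ) × ℝ => F (z.1.1, z.1.2 * z.2) - avg F z.1.1 :=
    ContDiff.sub (hF.comp (by fun_prop)) ((contDiff_avg hF).comp (by fun_prop))
  exact contDiff_snd.smul (contDiff_parametric_integral hd 0 1)

theorem partialFDeriv_oscPrim [ProperSpace P] [CompleteSpace G] {F : P × ℝ → G}
    (hF : ContDiff ℝ 1 F) : partialFDeriv (oscPrim F) = oscPrim (partialFDeriv F) := by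
  funext ⟨p, θ⟩
  have hd : ContDiff ℝ 1 fun z : P × ℝ => F z - avg F z.1 :=
    hF.sub ((contDiff_avg hF).comp contDiff_fst)
  have h := hasFDerivAt_parametric_integral hd 0 θ p
  refine Eq.trans h.fderiv ?_
  simp only [oscPrim]
  congr 1
  funext s
  exact ((hasFDerivAt_partial hF p s).sub (hasFDerivAt_avg hF p)).fderiv

theorem hasDerivAt_oscPrim [CompleteSpace G] {F : P × ℝ → G} (hF : Continuous F) (p : P) (θ : ℝ) :
    HasDerivAt (fun θ => oscPrim F (p, θ)) (F (p, θ) - avg F p) θ := by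
  have hc : Continuous fun s => F (p, s) - avg F p := by fun_prop
  exact hc.integral_hasStrictDerivAt 0 θ |>.hasDerivAt

theorem oscPrim_zero (F : P × ℝ → G) (p : P) : oscPrim F (p, 0) = 0 := by
  simp [oscPrim]

theorem integral_sub_avg [CompleteSpace G] {F : P × ℝ → G} (hF : Continuous F) (p : P) :
    ∫ s in 0..(2 * Real.pi), (F (p, s) - avg F p) = 0 := by
  have hc : Continuous fun s => F (p, s) := by fun_prop
  rw [intervalIntegral.integral_sub (hc.intervalIntegrable _ _) intervalIntegrable_const]
  rw [intervalIntegral.integral_const, sub_zero, avg, periodMean,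
    smul_inv_smul₀ Real.two_pi_pos.ne', sub_self]

/-- Subtracting the mean makes the integral over a full period vanish. This gives bounds uniform in
Ωt, and makes the correction vanish at stroboscopic times. -/
theorem periodic_oscPrim [CompleteSpace G] {F : P × ℝ → G} (hF : Continuous F)
    (hp : PeriodicInAngle F) : PeriodicInAngle (oscPrim F) := by
  intro p θ
  have hc : Continuous fun s => F (p, s) - avg F p := by fun_prop
  have hper : Function.Periodic (fun s => F (p, s) - avg F p) (2 * Real.pi) := fun s => by
    simp [hp p s]
  simp only [oscPrim]
  rw [← intervalIntegral.integral_add_adjacent_intervals (hc.intervalIntegrable 0 θ)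
    (hc.intervalIntegrable _ _), hper.intervalIntegral_add_eq θ 0, zero_add,
    integral_sub_avg hF p, add_zero]

theorem periodic_partialFDeriv {F : P × ℝ → G} (hp : PeriodicInAngle F) :
    PeriodicInAngle (partialFDeriv F) := by
  intro p θ
  simp only [partialFDeriv]
  congr 1
  funext x
  exact hp x θ

/-- Periodicity reduces the angle Ωt, which ranges over an interval growing with Ω, to a compact
one; this is why the later constants do not depend on Ω. -/
theorem PeriodicInAngle.exists_bound [ProperSpace P] {h : P × ℝ → G} (hp : PeriodicInAngle h)
    (hc : Continuous h) (M : ℝ) : ∃ B, 0 ≤ B ∧ ∀ p, ‖p‖ ≤ M → ∀ θ, ‖h (p, θ)‖ ≤ B := by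
  obtain ⟨B, hB0, hB⟩ := exists_bound_of_continuous hc M 0 (2 * Real.pi)
  refine ⟨B, hB0, fun p hpM θ => ?_⟩
  obtain ⟨y, hy, hyθ⟩ := (hp p).exists_mem_Ico₀ Real.two_pi_pos θ
  have := hB p hpM y ⟨hy.1, hy.2.le⟩
  exact (congrArg norm hyθ).trans_le this

theorem PeriodicInAngle.exists_lipschitz [ProperSpace P] {h : P × ℝ → G} (hp : PeriodicInAngle h)
    (hc : ContDiff ℝ 1 h) (M : ℝ) : ∃ L, 0 ≤ L ∧ ∀ p p', ‖p‖ ≤ M → ‖p'‖ ≤ M → ∀ θ,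
      ‖h (p', θ) - h (p, θ)‖ ≤ L * ‖p' - p‖ := by
  obtain ⟨L, hL0, hL⟩ := (periodic_partialFDeriv hp).exists_bound
    (contDiff_partialFDeriv (m := 0) hc (by simp)).continuous M
  refine ⟨L, hL0, fun p p' hpM hpM' θ => ?_⟩
  refine (convex_closedBall (0 : P) M).norm_image_sub_le_of_norm_hasFDerivWithin_le
    (f := fun p => h (p, θ)) (f' := fun p => partialFDeriv h (p, θ))
    (fun x _ => (hasFDerivAt_partial hc x θ).hasFDerivWithinAt) (fun x hx => hL x (by simpa using hx) θ)
    (by simpa using hpM) (by simpa using hpM')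

theorem PeriodicInAngle.exists_taylor [ProperSpace P] {h : P × ℝ → G} (hp : PeriodicInAngle h)
    (hc : ContDiff ℝ 2 h) (M : ℝ) : ∃ L, 0 ≤ L ∧ ∀ p p', ‖p‖ ≤ M → ‖p'‖ ≤ M → ∀ θ,
      ‖h (p', θ) - h (p, θ) - partialFDeriv h (p, θ) (p' - p)‖ ≤ L * ‖p' - p‖ ^ 2 := by
  have hc1 : ContDiff ℝ 1 h := hc.of_le (by norm_num)
  obtain ⟨L, hL0, hL⟩ := (periodic_partialFDeriv hp).exists_lipschitz
    (contDiff_partialFDeriv (m := 1) hc (by norm_num)) M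
  refine ⟨L, hL0, fun p p' hpM hpM' θ => ?_⟩
  have hseg : segment ℝ p p' ⊆ closedBall (0 : P) M :=
    (convex_closedBall (0 : P) M).segment_subset (by simpa using hpM) (by simpa using hpM')
  -- The mean value inequality is used on the segment rather than on the ball: there the derivative
  -- differs from its value at p by at most `L * ‖p' - p‖`, which supplies the second factor.
  have := (convex_segment p p').norm_image_sub_le_of_norm_hasFDerivWithin_le'
    (f := fun p => h (p, θ)) (f' := fun p => partialFDeriv h (p, θ))
    (φ := partialFDeriv h (p, θ)) (C := L * ‖p' - p‖)
    (fun x _ => (hasFDerivAt_partial hc1 x θ).hasFDerivWithinAt) (fun x hx => ?_)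
    (left_mem_segment ℝ p p') (right_mem_segment ℝ p p')
  · rw [pow_two, ← mul_assoc]; exact this
  · refine (hL p x hpM (by simpa using hseg hx) θ).trans ?_
    gcongr
    obtain ⟨s, hs, rfl⟩ := (segment_eq_image' ℝ p p' ▸ hx : x ∈ _)
    simp only [add_sub_cancel_left, norm_smul, Real.norm_eq_abs, abs_of_nonneg hs.1]
    exact mul_le_of_le_one_left (norm_nonneg _) hs.2

end Calculus

/-! ### The near-identity transformation, its integrated defect, and Grönwall's inequality -/

section Averaging

variable {E S G : Type*} [NormedAddCommGroup E] [NormedSpace ℝ E] [NormedAddCommGroup S]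
  [NormedSpace ℝ S] [NormedAddCommGroup G] [NormedSpace ℝ G]

theorem fderiv_prod_apply {H : S × ℝ → G} (hH : ContDiff ℝ 1 H) {s : S} {θ : ℝ} {d : G}
    (hd : HasDerivAt (fun θ => H (s, θ)) d θ) (v : S) (r : ℝ) :
    fderiv ℝ H (s, θ) (v, r) = partialFDeriv H (s, θ) v + r • d := by
  have hv : ((v, r) : S × ℝ) = ContinuousLinearMap.inl ℝ S ℝ v
      + r • ContinuousLinearMap.inr ℝ S ℝ 1 := by simp
  have h2 : fderiv ℝ H (s, θ) (ContinuousLinearMap.inr ℝ S ℝ 1) = d := by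
    have h := ((hH.differentiable one_ne_zero) (s, θ)).hasFDerivAt.comp θ
      (hasFDerivAt_prodMk_right (𝕜 := ℝ) s θ)
    exact h.hasDerivAt.unique hd
  rw [hv, map_add, map_smul, h2, partialFDeriv_eq hH]
  rfl

/-- With σ frozen at the start of a period of length h = 2π/Ω the integral over that period is zero,
so a period contributes only the drift error `L * Λ * h * h`. There are at most (b - a)/h full
periods, and the incomplete last one contributes at most `B * h`; the sum is O(1/Ω). -/
theorem norm_integral_oscillating_le [CompleteSpace G] {ρ : S × ℝ → G} (hρ : Continuous ρ)
    (hper : PeriodicInAngle ρ) (hmean : ∀ s, ∫ θ in 0..(2 * Real.pi), ρ (s, θ) = 0)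
    {σ : ℝ → S} {a b M Λ L B Ω : ℝ} (hΩ : 0 < Ω) (hab : a ≤ b) (hL0 : 0 ≤ L) (hB0 : 0 ≤ B)
    (hσ : ∀ t ∈ Icc a b, ‖σ t‖ ≤ M) (hσc : ContinuousOn σ (Icc a b)) (hΛ : 0 ≤ Λ)
    (hlip : ∀ s ∈ Icc a b, ∀ t ∈ Icc a b, s ≤ t → ‖σ t - σ s‖ ≤ Λ * (t - s))
    (hB : ∀ s, ‖s‖ ≤ M → ∀ θ, ‖ρ (s, θ)‖ ≤ B)
    (hL : ∀ s s', ‖s‖ ≤ M → ‖s'‖ ≤ M → ∀ θ, ‖ρ (s', θ) - ρ (s, θ)‖ ≤ L * ‖s' - s‖) :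
    ‖∫ t in a..b, ρ (σ t, Ω * t)‖ ≤ 2 * Real.pi * (L * Λ * (b - a) + B) / Ω := by
  set h := 2 * Real.pi / Ω with hh
  have hpi := Real.two_pi_pos
  have hh0 : 0 < h := by positivity
  have hcont : ContinuousOn (fun t => ρ (σ t, Ω * t)) (Icc a b) :=
    hρ.comp_continuousOn (hσc.prodMk (by fun_prop))
  have hint : ∀ c d, c ∈ Icc a b → d ∈ Icc a b →
      IntervalIntegrable (fun t => ρ (σ t, Ω * t)) volume c d := fun c d hc hd =>
    (hcont.mono (uIcc_subset_Icc hc hd)).intervalIntegrable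
  have hperiod : ∀ c, a ≤ c → c + h ≤ b →
      ‖∫ t in c..(c + h), ρ (σ t, Ω * t)‖ ≤ L * Λ * h * h := by
    intro c hac hcb
    have hc : c ∈ Icc a b := ⟨hac, by linarith⟩
    have hc' : c + h ∈ Icc a b := ⟨by linarith, hcb⟩
    have hz : ∫ t in c..(c + h), ρ (σ c, Ω * t) = 0 := by
      rw [intervalIntegral.integral_comp_mul_left (fun θ => ρ (σ c, θ)) hΩ.ne', mul_add]
      have : Ω * h = 2 * Real.pi := by rw [hh]; field_simp
      rw [this, (hper (σ c)).intervalIntegral_add_eq (Ω * c) 0, zero_add, hmean, smul_zero]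
    have hi : IntervalIntegrable (fun t => ρ (σ c, Ω * t)) volume c (c + h) :=
      (Continuous.intervalIntegrable (by fun_prop) _ _)
    rw [← sub_zero (∫ t in c..(c + h), ρ (σ t, Ω * t)), ← hz,
      ← intervalIntegral.integral_sub (hint _ _ hc hc') hi]
    have := intervalIntegral.norm_integral_le_of_norm_le_const (a := c) (b := c + h)
      (f := fun t => ρ (σ t, Ω * t) - ρ (σ c, Ω * t)) (C := L * Λ * h) ?_
    · simpa [abs_of_pos hh0] using this
    · intro t ht
      rw [uIoc_of_le (by linarith)] at ht
      have ht' : t ∈ Icc a b := ⟨by linarith [ht.1], by linarith [ht.2]⟩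
      refine (hL _ _ (hσ c hc) (hσ t ht') _).trans ?_
      rw [mul_assoc]
      refine mul_le_mul_of_nonneg_left ((hlip c hc t ht' ht.1.le).trans ?_) hL0
      exact mul_le_mul_of_nonneg_left (by linarith [ht.2]) hΛ
  have hsteps : ∀ n : ℕ, a + n * h ≤ b →
      ‖∫ t in a..(a + n * h), ρ (σ t, Ω * t)‖ ≤ n * (L * Λ * h * h) := by
    intro n
    induction n with
    | zero => intro _; simp
    | succ n ih =>
      intro hn
      push_cast at hn ⊢
      have hnh : 0 ≤ n * h := by positivity
      have e : a + (n + 1) * h = a + n * h + h := by ring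
      rw [e] at hn ⊢
      rw [← intervalIntegral.integral_add_adjacent_intervals (b := a + n * h)
        (hint _ _ ⟨le_rfl, hab⟩ ⟨by linarith, by linarith⟩)
        (hint _ _ ⟨by linarith, by linarith⟩ ⟨by linarith, hn⟩)]
      have h1 := ih (by linarith)
      have h2 := hperiod (a + n * h) (by linarith) hn
      refine (norm_add_le _ _).trans ?_
      linarith
  set n := ⌊(b - a) / h⌋₊ with hn
  have hn1 : n * h ≤ b - a := by
    rw [← le_div_iff₀ hh0]
    exact Nat.floor_le (div_nonneg (by linarith) hh0.le)
  have hn2 : b - a ≤ n * h + h := by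
    have := (Nat.lt_floor_add_one ((b - a) / h)).le
    rw [div_le_iff₀ hh0] at this
    linarith
  have hnh : 0 ≤ n * h := by positivity
  have hmem : a + n * h ∈ Icc a b := ⟨by linarith, by linarith⟩
  rw [← intervalIntegral.integral_add_adjacent_intervals (b := a + n * h)
    (hint _ _ ⟨le_rfl, hab⟩ hmem) (hint _ _ hmem ⟨hab, le_rfl⟩)]
  have h1 := hsteps n hmem.2
  have h2 : ‖∫ t in (a + n * h)..b, ρ (σ t, Ω * t)‖ ≤ B * h := by
    refine (intervalIntegral.norm_integral_le_of_norm_le_const (C := B) fun t ht => ?_).trans ?_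
    · rw [uIoc_of_le hmem.2] at ht
      exact hB _ (hσ t ⟨by linarith [ht.1], ht.2⟩) _
    · rw [abs_of_nonneg (by linarith [hmem.2])]
      exact mul_le_mul_of_nonneg_left (by linarith) hB0
  have h3 : n * (L * Λ * h * h) ≤ L * Λ * (b - a) * h := by
    have : n * (L * Λ * h * h) = L * Λ * h * (n * h) := by ring
    rw [this]
    have := mul_le_mul_of_nonneg_left hn1 (show 0 ≤ L * Λ * h by positivity)
    linarith
  refine (norm_add_le _ _).trans ?_
  have e : 2 * Real.pi * (L * Λ * (b - a) + B) / Ω = L * Λ * (b - a) * h + B * h := by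
    rw [hh]; ring
  rw [e]; linarith

/-- With slow variable `s`, `p s` the current and the delayed value of the averaged solution,
`b` the first-order oscillation of the delayed value and `c` its velocity, this is the
first-order defect of the near-identity change of variables before averaging. -/
def residual (F : (E × E) × ℝ → E) (p : S → E × E) (b : S × ℝ → E) (c : S → E) (q : S × ℝ) : E :=
  partialFDeriv F (p q.1, q.2) (oscPrim F (p q.1, q.2), b q)
    - oscPrim (partialFDeriv F) (p q.1, q.2) (avg F (p q.1), c q.1)

variable {F : (E × E) × ℝ → E} {p : S → E × E} {b : S × ℝ → E} {c : S → E}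

theorem contDiff_residual [ProperSpace E] (hF : ContDiff ℝ 2 F) (hp : ContDiff ℝ 1 p)
    (hb : ContDiff ℝ 1 b) (hc : ContDiff ℝ 1 c) : ContDiff ℝ 1 (residual F p b c) := by
  have hF1 : ContDiff ℝ 1 F := hF.of_le (by norm_num)
  have hA : ContDiff ℝ 1 (partialFDeriv F) := contDiff_partialFDeriv hF (by norm_num)
  have hpq : ContDiff ℝ 1 fun q : S × ℝ => (p q.1, q.2) := by fun_prop
  exact ((hA.comp hpq).clm_apply (((contDiff_oscPrim hF1).comp hpq).prodMk hb)).sub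
    (((contDiff_oscPrim hA).comp hpq).clm_apply
      (((contDiff_avg hF1).comp (hp.comp contDiff_fst)).prodMk (hc.comp contDiff_fst)))

theorem periodic_residual [ProperSpace E] (hF : ContDiff ℝ 2 F) (hFp : PeriodicInAngle F)
    (hbp : PeriodicInAngle b) : PeriodicInAngle (residual F p b c) := by
  have hF1 : ContDiff ℝ 1 F := hF.of_le (by norm_num)
  have hA : ContDiff ℝ 1 (partialFDeriv F) := contDiff_partialFDeriv hF (by norm_num)
  intro s θ
  have h1 := periodic_partialFDeriv hFp (p s) θ
  have h2 := periodic_oscPrim hF.continuous hFp (p s) θ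
  have h3 := hbp s θ
  have h4 := periodic_oscPrim hA.continuous (periodic_partialFDeriv hFp) (p s) θ
  simp only at h1 h2 h3 h4
  simp only [residual, h1, h2, h3, h4]

/-- The angle moves with speed Ω, which cancels the prefactor Ω⁻¹: the θ-derivative of u enters at
order one, as F minus its mean. -/
theorem hasDerivWithinAt_nearIdentity [ProperSpace E] (hF : ContDiff ℝ 2 F) {q : ℝ → E × E}
    {q' : E × E} {Ω t : ℝ} {s : Set ℝ} (hΩ : Ω ≠ 0) (hq : HasDerivWithinAt q q' s t) :
    HasDerivWithinAt (fun t => (q t).1 + Ω⁻¹ • oscPrim F (q t, Ω * t))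
      (q'.1 + Ω⁻¹ • oscPrim (partialFDeriv F) (q t, Ω * t) q'
        + (F (q t, Ω * t) - avg F (q t))) s t := by
  have hF1 : ContDiff ℝ 1 F := hF.of_le (by norm_num)
  have hu := contDiff_oscPrim hF1
  have h1 : HasDerivWithinAt (fun t => (q t, Ω * t)) (q', Ω) s t :=
    hq.prodMk (by simpa using ((hasDerivAt_id t).const_mul Ω).hasDerivWithinAt)
  have h2 := ((hu.differentiable one_ne_zero) (q t, Ω * t)).hasFDerivAt.comp_hasDerivWithinAt t h1
  rw [fderiv_prod_apply hu (hasDerivAt_oscPrim hF.continuous (q t) (Ω * t)),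
    partialFDeriv_oscPrim hF1] at h2
  have hfst : HasDerivWithinAt (fun t => (q t).1) q'.1 s t :=
    (ContinuousLinearMap.fst ℝ E E).hasFDerivAt.comp_hasDerivWithinAt t hq
  have h3 := hfst.add (h2.const_smul Ω⁻¹)
  rw [smul_add, inv_smul_smul₀ hΩ, ← add_assoc] at h3
  exact h3

/-- The mean of `residual` is absorbed in the averaged equation; its mean-free part ρ is only O(1/Ω)
pointwise, so the defect is estimated after integration. The velocity V of the delayed value may
differ from the model velocity c by O(1/Ω), because it enters with a prefactor Ω⁻¹. The slow
variable σ need only be Lipschitz; just p ∘ σ is differentiated, and only from the right. -/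
theorem exists_defect_bound [ProperSpace E] [ProperSpace S] (hF : ContDiff ℝ 2 F)
    (hFp : PeriodicInAngle F) (hp : ContDiff ℝ 1 p) (hb : ContDiff ℝ 1 b)
    (hbp : PeriodicInAngle b) (hc : ContDiff ℝ 1 c) (M Λ Cv T : ℝ) (hΛ : 0 ≤ Λ) (hCv : 0 ≤ Cv)
    (hT : 0 ≤ T) : ∃ C, 0 ≤ C ∧ ∀ Ω, 1 ≤ Ω → ∀ t₀ t₁, t₀ ≤ t₁ → t₁ - t₀ ≤ T →
      ∀ (σ : ℝ → S) (V : ℝ → E), (∀ t ∈ Icc t₀ t₁, ‖σ t‖ ≤ M) →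
      (∀ s ∈ Icc t₀ t₁, ∀ t ∈ Icc t₀ t₁, s ≤ t → ‖σ t - σ s‖ ≤ Λ * (t - s)) →
      (∀ t ∈ Ico t₀ t₁, HasDerivWithinAt (fun t => p (σ t))
        (avg F (p (σ t)) + Ω⁻¹ • avg (residual F p b c) (σ t), V t) (Ici t) t) →
      (∀ t ∈ Ico t₀ t₁, ‖V t - c (σ t)‖ ≤ Cv / Ω) →
      ContinuousOn (fun t => F (p (σ t) + Ω⁻¹ • (oscPrim F (p (σ t), Ω * t), b (σ t, Ω * t)),
          Ω * t)) (Icc t₀ t₁) ∧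
      ‖((p (σ t₁)).1 + Ω⁻¹ • oscPrim F (p (σ t₁), Ω * t₁))
        - ((p (σ t₀)).1 + Ω⁻¹ • oscPrim F (p (σ t₀), Ω * t₀))
        - ∫ t in t₀..t₁, F (p (σ t) + Ω⁻¹ • (oscPrim F (p (σ t), Ω * t), b (σ t, Ω * t)),
          Ω * t)‖ ≤ C / Ω ^ 2 := by
  have hF1 : ContDiff ℝ 1 F := hF.of_le (by norm_num)
  have hA : ContDiff ℝ 1 (partialFDeriv F) := contDiff_partialFDeriv hF (by norm_num)
  have hu := contDiff_oscPrim hF1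
  have hup := periodic_oscPrim hF.continuous hFp
  have hr := contDiff_residual hF hp hb hc
  have hrp : PeriodicInAngle (residual F p b c) := periodic_residual hF hFp hbp
  have hg := contDiff_avg hr
  have hpc : PeriodicInAngle fun q : S × ℝ => p q.1 := fun _ _ => rfl
  set ρ : S × ℝ → E := fun q => residual F p b c q - avg (residual F p b c) q.1 with hρ
  have hρc : ContDiff ℝ 1 ρ := hr.sub (hg.comp contDiff_fst)
  have hρp : PeriodicInAngle ρ := fun s θ => by
    have := hrp s θ
    simp only at this
    simp only [hρ, this]
  have hgp : PeriodicInAngle fun q : S × ℝ => avg (residual F p b c) q.1 := fun _ _ => rfl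
  obtain ⟨Mp, hMp0, hMp⟩ := hpc.exists_bound (hp.continuous.comp continuous_fst) M
  obtain ⟨Bu, hBu0, hBu⟩ := hup.exists_bound hu.continuous Mp
  obtain ⟨Bb, hBb0, hBb⟩ := hbp.exists_bound hb.continuous M
  obtain ⟨Bg, hBg0, hBg⟩ := hgp.exists_bound (hg.continuous.comp continuous_fst) M
  obtain ⟨BD, hBD0, hBD⟩ := (periodic_oscPrim hA.continuous
    (periodic_partialFDeriv hFp)).exists_bound (contDiff_oscPrim hA).continuous Mp
  obtain ⟨Bρ, hBρ0, hBρ⟩ := hρp.exists_bound hρc.continuous M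
  obtain ⟨Lρ, hLρ0, hLρ⟩ := hρp.exists_lipschitz hρc M
  -- Since Ω ≥ 1, this radius also contains the point shifted by Ω⁻¹ (u, b).
  obtain ⟨LT, hLT0, hLT⟩ := hFp.exists_taylor hF (Mp + (Bu + Bb))
  set K := LT * (Bu + Bb) ^ 2 + BD * (Bg + Cv) with hK
  have hK0 : 0 ≤ K := by positivity
  have hpi := Real.two_pi_pos
  refine ⟨K * T + 2 * Real.pi * (Lρ * Λ * T + Bρ), by positivity, ?_⟩
  intro Ω hΩ t₀ t₁ ht htT σ V hσM hσL hσd hV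
  have hΩ0 : 0 < Ω := by linarith
  have hε1 : Ω⁻¹ ≤ 1 := inv_le_one_of_one_le₀ hΩ
  have hε0 : 0 < Ω⁻¹ := inv_pos.2 hΩ0
  have hσc : ContinuousOn σ (Icc t₀ t₁) := by
    refine LipschitzOnWith.continuousOn (K := ⟨Λ, hΛ⟩) (LipschitzOnWith.of_dist_le_mul ?_)
    intro s hs t ht'
    rcases le_total s t with hst | hst
    · rw [dist_comm, dist_comm s, dist_eq_norm, Real.dist_eq, abs_of_nonneg (by linarith)]
      exact hσL s hs t ht' hst
    · rw [dist_eq_norm, Real.dist_eq, abs_of_nonneg (by linarith)]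
      exact hσL t ht' s hs hst
  have hpσ : ContinuousOn (fun t => p (σ t)) (Icc t₀ t₁) := hp.continuous.comp_continuousOn hσc
  have hΩt : ContinuousOn (fun t : ℝ => Ω * t) (Icc t₀ t₁) := by fun_prop
  have huc : ContinuousOn (fun t => oscPrim F (p (σ t), Ω * t)) (Icc t₀ t₁) :=
    hu.continuous.comp_continuousOn (hpσ.prodMk hΩt)
  have hbc : ContinuousOn (fun t => b (σ t, Ω * t)) (Icc t₀ t₁) :=
    hb.continuous.comp_continuousOn (hσc.prodMk hΩt)
  have hFc : ContinuousOn (fun t => F (p (σ t) + Ω⁻¹ • (oscPrim F (p (σ t), Ω * t),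
      b (σ t, Ω * t)), Ω * t)) (Icc t₀ t₁) := by
    have h1 : ContinuousOn (fun t => p (σ t) + Ω⁻¹ • (oscPrim F (p (σ t), Ω * t),
        b (σ t, Ω * t))) (Icc t₀ t₁) := hpσ.add ((huc.prodMk hbc).const_smul Ω⁻¹)
    exact hF.continuous.comp_continuousOn (h1.prodMk hΩt)
  have hρcont : ContinuousOn (fun t => ρ (σ t, Ω * t)) (Icc t₀ t₁) :=
    hρc.continuous.comp_continuousOn (hσc.prodMk hΩt)
  refine ⟨hFc, ?_⟩
  set w : ℝ → E := fun t => (p (σ t)).1 + Ω⁻¹ • oscPrim F (p (σ t), Ω * t) with hw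
  set k : ℝ → E := fun t => F (p (σ t) + Ω⁻¹ • (oscPrim F (p (σ t), Ω * t),
      b (σ t, Ω * t)), Ω * t) with hk
  -- Removing the mean-free oscillation leaves w' - h = O(Ω⁻²) pointwise; the integral of Ω⁻¹ρ is
  -- estimated separately.
  set h : ℝ → E := fun t => k t - Ω⁻¹ • ρ (σ t, Ω * t) with hh
  have hhc : ContinuousOn h (Icc t₀ t₁) := hFc.sub (continuousOn_const.smul hρcont)
  have hwc : ContinuousOn w (Icc t₀ t₁) := hpσ.fst.add (continuousOn_const.smul huc)
  have hmain : ‖(w t₁ - ∫ t in t₀..t₁, h t) - (w t₀ - ∫ t in t₀..t₀, h t)‖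
      ≤ K / Ω ^ 2 * (t₁ - t₀) := by
    refine norm_image_sub_le_of_norm_deriv_right_le_segment
      (f := fun s => w s - ∫ t in t₀..s, h t)
      (f' := fun t => ((avg F (p (σ t)) + Ω⁻¹ • avg (residual F p b c) (σ t))
        + Ω⁻¹ • oscPrim (partialFDeriv F) (p (σ t), Ω * t)
          (avg F (p (σ t)) + Ω⁻¹ • avg (residual F p b c) (σ t), V t)
        + (F (p (σ t), Ω * t) - avg F (p (σ t)))) - h t) ?_ ?_ ?_ t₁ ⟨ht, le_rfl⟩
    · refine hwc.sub ?_
      have := intervalIntegral.continuousOn_primitive_interval (μ := volume) (f := h) (a := t₀)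
        (b := t₁) (by rw [uIcc_of_le ht]; exact hhc.integrableOn_Icc)
      rwa [uIcc_of_le ht] at this
    · intro t ht'
      refine (hasDerivWithinAt_nearIdentity hF hΩ0.ne' (hσd t ht')).sub ?_
      have hnt : Icc t₀ t₁ ∈ 𝓝[>] t :=
        mem_of_superset (Ioc_mem_nhdsGT ht'.2) fun z hz => ⟨ht'.1.trans hz.1.le, hz.2⟩
      refine intervalIntegral.integral_hasDerivWithinAt_right (t := Ioi t) ?_ ?_ ?_
      · exact (hhc.mono (uIcc_subset_Icc ⟨le_rfl, ht⟩ ⟨ht'.1, ht'.2.le⟩)).intervalIntegrable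
      · exact ⟨Icc t₀ t₁, hnt, hhc.aestronglyMeasurable measurableSet_Icc⟩
      · exact (hhc t ⟨ht'.1, ht'.2.le⟩).mono_of_mem_nhdsWithin hnt
    · intro t ht'
      have htI : t ∈ Icc t₀ t₁ := ⟨ht'.1, ht'.2.le⟩
      have hs := hσM t htI
      have hq := hMp (σ t) hs 0
      have hVt := hV t ht'
      simp only [hh, hk, hρ, residual]
      have b1 := hBu _ hq (Ω * t)
      have b2 := hBb _ hs (Ω * t)
      have b3 := hBg _ hs 0
      have b4 := hBD _ hq (Ω * t)
      simp only at b3 hq b1 b4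
      have b5 := hLT (p (σ t)) (p (σ t) + Ω⁻¹ • (oscPrim F (p (σ t), Ω * t), b (σ t, Ω * t)))
        (by linarith) ?_ (Ω * t)
      swap
      · refine (norm_add_le _ _).trans (add_le_add hq ?_)
        rw [norm_smul, Real.norm_of_nonneg hε0.le]
        refine (mul_le_of_le_one_left (norm_nonneg _) hε1).trans ?_
        exact (norm_prod_le_iff.2 ⟨by simpa using by linarith, by simpa using by linarith⟩)
      generalize avg (residual F p b c) (σ t) = g at *
      generalize oscPrim F (p (σ t), Ω * t) = u at *
      generalize b (σ t, Ω * t) = bb at *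
      generalize oscPrim (partialFDeriv F) (p (σ t), Ω * t) = Dd at *
      generalize partialFDeriv F (p (σ t), Ω * t) = A at *
      generalize c (σ t) = cc at *
      generalize avg F (p (σ t)) = f0 at *
      generalize F (p (σ t) + Ω⁻¹ • (u, bb), Ω * t) = F1 at *
      generalize F (p (σ t), Ω * t) = F0 at *
      rw [add_sub_cancel_left] at b5
      -- All terms of orders 1 and Ω⁻¹ cancel. What remains is the second-order error in the
      -- velocities and the Taylor remainder of F.
      have e : f0 + Ω⁻¹ • g + Ω⁻¹ • Dd (f0 + Ω⁻¹ • g, V t) + (F0 - f0)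
          - (F1 - Ω⁻¹ • (A (u, bb) - Dd (f0, cc) - g))
          = Ω⁻¹ • Dd (Ω⁻¹ • g, V t - cc) - (F1 - F0 - A (Ω⁻¹ • (u, bb))) := by
        have e1 : ((f0 + Ω⁻¹ • g, V t) : E × E) = (f0, cc) + (Ω⁻¹ • g, V t - cc) := by simp
        rw [e1, map_add, map_smul]
        module
      rw [e]
      have n1 : ‖((u, bb) : E × E)‖ ≤ Bu + Bb :=
        norm_prod_le_iff.2 ⟨by simpa using by linarith, by simpa using by linarith⟩
      have n2 : ‖((Ω⁻¹ • g, V t - cc) : E × E)‖ ≤ Ω⁻¹ * (Bg + Cv) := by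
        refine norm_prod_le_iff.2 ⟨?_, ?_⟩
        · simp only [norm_smul, Real.norm_of_nonneg hε0.le]
          gcongr; linarith
        · simp only
          refine hVt.trans ?_
          rw [div_eq_inv_mul]
          gcongr; linarith
      have n3 : ‖Ω⁻¹ • Dd (Ω⁻¹ • g, V t - cc)‖ ≤ BD * (Bg + Cv) / Ω ^ 2 := by
        rw [norm_smul, Real.norm_of_nonneg hε0.le]
        calc Ω⁻¹ * ‖Dd (Ω⁻¹ • g, V t - cc)‖ ≤ Ω⁻¹ * (BD * (Ω⁻¹ * (Bg + Cv))) := by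
              gcongr; exact Dd.le_of_opNorm_le_of_le b4 n2
          _ = _ := by field_simp
      have n4 : ‖F1 - F0 - A (Ω⁻¹ • (u, bb))‖ ≤ LT * (Bu + Bb) ^ 2 / Ω ^ 2 := by
        refine b5.trans ?_
        rw [norm_smul, Real.norm_of_nonneg hε0.le]
        calc LT * (Ω⁻¹ * ‖((u, bb) : E × E)‖) ^ 2 ≤ LT * (Ω⁻¹ * (Bu + Bb)) ^ 2 := by gcongr
          _ = _ := by field_simp
      refine (norm_sub_le _ _).trans ((add_le_add n3 n4).trans_eq ?_)
      rw [hK]; ring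
  have hosc := norm_integral_oscillating_le hρc.continuous hρp
    (fun s => integral_sub_avg hr.continuous s) hΩ0 ht hLρ0 hBρ0 hσM hσc hΛ hσL hBρ hLρ
  have hki : IntervalIntegrable k volume t₀ t₁ := hFc.intervalIntegrable_of_Icc ht
  have hρi : IntervalIntegrable (fun t => ρ (σ t, Ω * t)) volume t₀ t₁ :=
    hρcont.intervalIntegrable_of_Icc ht
  have hρi' : IntervalIntegrable (fun t => Ω⁻¹ • ρ (σ t, Ω * t)) volume t₀ t₁ := hρi.smul Ω⁻¹
  have hsplit : ∫ t in t₀..t₁, h t =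
      (∫ t in t₀..t₁, k t) - Ω⁻¹ • ∫ t in t₀..t₁, ρ (σ t, Ω * t) := by
    rw [← intervalIntegral.integral_smul]
    exact intervalIntegral.integral_sub hki hρi'
  rw [hsplit, intervalIntegral.integral_same, sub_zero] at hmain
  have e : w t₁ - w t₀ - ∫ t in t₀..t₁, k t = (w t₁ - ((∫ t in t₀..t₁, k t)
      - Ω⁻¹ • ∫ t in t₀..t₁, ρ (σ t, Ω * t)) - w t₀) - Ω⁻¹ • ∫ t in t₀..t₁, ρ (σ t, Ω * t) := by
    abel
  rw [e]
  refine (norm_sub_le _ _).trans ?_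
  rw [norm_smul, Real.norm_of_nonneg hε0.le]
  have b1 : K / Ω ^ 2 * (t₁ - t₀) ≤ K * T / Ω ^ 2 := by
    rw [div_mul_eq_mul_div]
    gcongr
  have b2 : Ω⁻¹ * ‖∫ t in t₀..t₁, ρ (σ t, Ω * t)‖
      ≤ 2 * Real.pi * (Lρ * Λ * T + Bρ) / Ω ^ 2 := by
    calc _ ≤ Ω⁻¹ * (2 * Real.pi * (Lρ * Λ * (t₁ - t₀) + Bρ) / Ω) := by gcongr
      _ = 2 * Real.pi * (Lρ * Λ * (t₁ - t₀) + Bρ) / Ω ^ 2 := by field_simp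
      _ ≤ _ := by gcongr
  rw [add_div]
  linarith

/-- Grönwall's inequality in integral form. -/
theorem le_mul_exp_of_le_add_integral {e : ℝ → ℝ} {a b δ K : ℝ} (hK : 0 ≤ K)
    (he : ContinuousOn e (Icc a b))
    (h : ∀ t ∈ Icc a b, e t ≤ δ + K * ∫ s in a..t, e s) :
    ∀ t ∈ Icc a b, e t ≤ δ * Real.exp (K * (t - a)) := by
  intro t ht
  have hab : a ≤ b := ht.1.trans ht.2
  have := le_gronwallBound_of_liminf_deriv_right_le (f := fun t => δ + K * ∫ s in a..t, e s)
    (f' := fun t => K * e t) (δ := δ) (K := K) (ε := 0) (a := a) (b := b) ?_ ?_ ?_ ?_ t ht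
  · rw [gronwallBound_ε0] at this
    exact (h t ht).trans this
  · refine continuousOn_const.add (continuousOn_const.mul ?_)
    have := intervalIntegral.continuousOn_primitive_interval (μ := volume) (f := e) (a := a)
      (b := b) (by rw [uIcc_of_le hab]; exact he.integrableOn_Icc)
    rwa [uIcc_of_le hab] at this
  · intro x hx r hr
    have hnt : Icc a b ∈ 𝓝[>] x :=
      mem_of_superset (Ioc_mem_nhdsGT hx.2) fun z hz => ⟨hx.1.trans hz.1.le, hz.2⟩
    have hd : HasDerivWithinAt (fun t => δ + K * ∫ s in a..t, e s) (K * e x) (Ici x) x := by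
      refine ((intervalIntegral.integral_hasDerivWithinAt_right (t := Ioi x) ?_ ?_ ?_).const_mul
        K).const_add δ
      · exact (he.mono (uIcc_subset_Icc ⟨le_rfl, hab⟩ ⟨hx.1, hx.2.le⟩)).intervalIntegrable
      · exact ⟨Icc a b, hnt, he.aestronglyMeasurable measurableSet_Icc⟩
      · exact (he x ⟨hx.1, hx.2.le⟩).mono_of_mem_nhdsWithin hnt
    exact (hd.liminf_right_slope_le hr)
  · simp
  · intro x hx
    rw [add_zero]
    exact mul_le_mul_of_nonneg_left (h x ⟨hx.1, hx.2.le⟩) hK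

end Averaging

/-! ### Comparison of the two delay solutions and the a priori bound -/

section ErrorBound

variable {E : Type*} [NormedAddCommGroup E] [NormedSpace ℝ E]

/-- The averaged vector field on the first delay interval, with slow variable `((x, y), v)`. -/
def avgField₁ (F : (E × E) × ℝ → E) (Ω : ℝ) (s : (E × E) × E) : E :=
  avg F s.1 + Ω⁻¹ • avg (residual F Prod.fst (fun _ => 0) Prod.snd) s

/-- The averaged vector field after the first delay interval, with slow variable `((x, y), z)`. -/
def avgField₂ (F : (E × E) × ℝ → E) (Ω : ℝ) (s : (E × E) × E) : E :=
  avg F s.1 + Ω⁻¹ • avg (residual F Prod.fst (fun q => oscPrim F ((q.1.1.2, q.1.2), q.2))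
    (fun s => avg F (s.1.2, s.2))) s

/-- `x` solves the oscillatory and `X` the averaged delay equation on `[0, T]`, in terms of
derivatives from the right. -/
structure IsSolutionPair (F : (E × E) × ℝ → E) (φ φ' : ℝ → E) (τ Ω T : ℝ) (x X : ℝ → E) :
    Prop where
  history : ∀ t ∈ Icc (-τ) 0, x t = φ t
  history_avg : ∀ t ∈ Icc (-τ) 0, X t = φ t
  continuousOn : ContinuousOn x (Icc (-τ) T)
  continuousOn_avg : ContinuousOn X (Icc (-τ) T)
  eqn : ∀ t ∈ Ico 0 T, HasDerivWithinAt x (F ((x t, x (t - τ)), Ω * t)) (Ici t) t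
  eqn_avg₁ : ∀ t ∈ Ico 0 T, t < τ →
    HasDerivWithinAt X (avgField₁ F Ω ((X t, X (t - τ)), φ' (t - τ))) (Ici t) t
  eqn_avg₂ : ∀ t ∈ Ico 0 T, τ ≤ t →
    HasDerivWithinAt X (avgField₂ F Ω ((X t, X (t - τ)), X (t - 2 * τ))) (Ici t) t

variable {F : (E × E) × ℝ → E} {φ φ' x X : ℝ → E} {τ Ω T : ℝ}

theorem IsSolutionPair.mono (h : IsSolutionPair F φ φ' τ Ω T x X) {T' : ℝ} (hT : T' ≤ T) :
    IsSolutionPair F φ φ' τ Ω T' x X where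
  history := h.history
  history_avg := h.history_avg
  continuousOn := h.continuousOn.mono (Icc_subset_Icc_right hT)
  continuousOn_avg := h.continuousOn_avg.mono (Icc_subset_Icc_right hT)
  eqn t ht := h.eqn t ⟨ht.1, ht.2.trans_le hT⟩
  eqn_avg₁ t ht := h.eqn_avg₁ t ⟨ht.1, ht.2.trans_le hT⟩
  eqn_avg₂ t ht := h.eqn_avg₂ t ⟨ht.1, ht.2.trans_le hT⟩

theorem hasDerivWithinAt_comp_sub {Y : ℝ → E} {d : E} {t : ℝ}
    (h : HasDerivWithinAt Y d (Ici (t - τ)) (t - τ)) :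
    HasDerivWithinAt (fun s => Y (s - τ)) d (Ici t) t := by
  have h1 : HasDerivWithinAt (fun s : ℝ => s - τ) 1 (Ici t) t :=
    ((hasDerivAt_id t).sub_const τ).hasDerivWithinAt
  have h2 := h.scomp t h1 fun s hs => sub_le_sub_right (mem_Ici.1 hs) τ
  rwa [one_smul] at h2

theorem IsSolutionPair.hasDeriv_history (h : IsSolutionPair F φ φ' τ Ω T x X)
    (hφ : ∀ t ∈ Ico (-τ) 0, HasDerivWithinAt φ (φ' t) (Ici t) t) {t : ℝ} (ht : t ∈ Ico (-τ) 0) :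
    HasDerivWithinAt X (φ' t) (Ici t) t := by
  refine (hφ t ht).congr_of_eventuallyEq ?_ (h.history_avg t ⟨ht.1, ht.2.le⟩)
  filter_upwards [Icc_mem_nhdsGE ht.2] with s hs
  exact h.history_avg s ⟨ht.1.trans hs.1, hs.2⟩

/-- The derivative of X may jump at 0 and at τ, but right derivatives exist throughout and suffice
for the mean value inequality, so one constant serves the history and both delay regimes. -/
theorem IsSolutionPair.lipschitz_avg (h : IsSolutionPair F φ φ' τ Ω T x X) (hτ : 0 < τ)
    (hφ : ∀ t ∈ Ico (-τ) 0, HasDerivWithinAt φ (φ' t) (Ici t) t) {M Λ : ℝ}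
    (hφ'M : ∀ t ∈ Icc (-τ) 0, ‖φ' t‖ ≤ M) (hM : ∀ t ∈ Icc (-τ) T, ‖X t‖ ≤ M)
    (hΛ : M ≤ Λ) (h₁ : ∀ s, ‖s‖ ≤ M → ‖avgField₁ F Ω s‖ ≤ Λ)
    (h₂ : ∀ s, ‖s‖ ≤ M → ‖avgField₂ F Ω s‖ ≤ Λ) :
    ∀ s ∈ Icc (-τ) T, ∀ t ∈ Icc (-τ) T, s ≤ t → ‖X t - X s‖ ≤ Λ * (t - s) := by
  intro s hs t ht hst
  classical
  refine norm_image_sub_le_of_norm_deriv_right_le_segment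
    (f' := fun r => if r < 0 then φ' r else if r < τ then
      avgField₁ F Ω ((X r, X (r - τ)), φ' (r - τ)) else
      avgField₂ F Ω ((X r, X (r - τ)), X (r - 2 * τ)))
    (h.continuousOn_avg.mono (Icc_subset_Icc hs.1 ht.2)) ?_ ?_ t ⟨hst, le_rfl⟩
  · intro r hr
    have hrT : r < T := hr.2.trans_le ht.2
    have hr0 : -τ ≤ r := hs.1.trans hr.1
    split_ifs with h1 h2
    · exact h.hasDeriv_history hφ ⟨hr0, h1⟩
    · exact h.eqn_avg₁ r ⟨not_lt.1 h1, hrT⟩ h2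
    · exact h.eqn_avg₂ r ⟨not_lt.1 h1, hrT⟩ (not_lt.1 h2)
  · intro r hr
    have hrT : r < T := hr.2.trans_le ht.2
    have hr0 : -τ ≤ r := hs.1.trans hr.1
    split_ifs with h1 h2
    · exact (hφ'M r ⟨hr0, h1.le⟩).trans hΛ
    · refine h₁ _ (norm_prod_le_iff.2 ⟨norm_prod_le_iff.2 ⟨hM _ ?_, hM _ ?_⟩, hφ'M _ ?_⟩) <;>
        constructor <;> linarith
    · refine h₂ _ (norm_prod_le_iff.2 ⟨norm_prod_le_iff.2 ⟨hM _ ?_, hM _ ?_⟩, hM _ ?_⟩) <;>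
        constructor <;> linarith

/-- The first-order approximation of the oscillatory solution. -/
def nearIdentity (F : (E × E) × ℝ → E) (τ Ω : ℝ) (X : ℝ → E) (t : ℝ) : E :=
  X t + Ω⁻¹ • oscPrim F ((X t, X (t - τ)), Ω * t)

/-- Comparison of `x` with an approximate solution `w` with small integrated defect. -/
theorem norm_sub_le_of_defect [CompleteSpace E] {w xd wd : ℝ → E} {d : ℝ → ℝ} {t₀ t₁ δ L M : ℝ}
    (ht : t₀ ≤ t₁) (hF : Continuous F)
    (hx : ContinuousOn x (Icc t₀ t₁)) (hxd : ContinuousOn xd (Icc t₀ t₁))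
    (hw : ContinuousOn w (Icc t₀ t₁)) (hd : ContinuousOn d (Icc t₀ t₁))
    (hk : ContinuousOn (fun t => F ((w t, wd t), Ω * t)) (Icc t₀ t₁))
    (hx' : ∀ t ∈ Ico t₀ t₁, HasDerivWithinAt x (F ((x t, xd t), Ω * t)) (Ici t) t)
    (hδ : ‖w t₁ - w t₀ - ∫ t in t₀..t₁, F ((w t, wd t), Ω * t)‖ ≤ δ)
    (hxM : ∀ t ∈ Icc t₀ t₁, ‖x t‖ ≤ M) (hxdM : ∀ t ∈ Icc t₀ t₁, ‖xd t‖ ≤ M)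
    (hwM : ∀ t ∈ Icc t₀ t₁, ‖w t‖ ≤ M) (hwdM : ∀ t ∈ Icc t₀ t₁, ‖wd t‖ ≤ M) (hL0 : 0 ≤ L)
    (hL : ∀ p p', ‖p‖ ≤ M → ‖p'‖ ≤ M → ∀ θ, ‖F (p', θ) - F (p, θ)‖ ≤ L * ‖p' - p‖)
    (hdle : ∀ t ∈ Icc t₀ t₁, ‖xd t - wd t‖ ≤ d t) :
    ‖x t₁ - w t₁‖ ≤ ‖x t₀ - w t₀‖ + δ + L * ((∫ t in t₀..t₁, ‖x t - w t‖) + ∫ t in t₀..t₁, d t) := by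
  have hl : ContinuousOn (fun t => F ((x t, xd t), Ω * t)) (Icc t₀ t₁) :=
    hF.comp_continuousOn ((hx.prodMk hxd).prodMk (by fun_prop))
  have hli : IntervalIntegrable (fun t => F ((x t, xd t), Ω * t)) volume t₀ t₁ :=
    hl.intervalIntegrable_of_Icc ht
  have hki := hk.intervalIntegrable_of_Icc (μ := volume) ht
  have hftc := intervalIntegral.integral_eq_sub_of_hasDeriv_right_of_le ht hx
    (fun t ht' => (hx' t ⟨ht'.1.le, ht'.2⟩).mono Ioi_subset_Ici_self) hli
  have hei : ContinuousOn (fun t => ‖x t - w t‖) (Icc t₀ t₁) := (hx.sub hw).norm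
  have hei' := hei.intervalIntegrable_of_Icc (μ := volume) ht
  have hdi := hd.intervalIntegrable_of_Icc (μ := volume) ht
  have hdiff : ‖∫ t in t₀..t₁, (F ((x t, xd t), Ω * t) - F ((w t, wd t), Ω * t))‖
      ≤ ∫ t in t₀..t₁, L * (‖x t - w t‖ + d t) := by
    refine intervalIntegral.norm_integral_le_of_norm_le ht ?_ ((hei'.add hdi).const_mul L)
    refine Eventually.of_forall fun t ht' => ?_
    have htI : t ∈ Icc t₀ t₁ := ⟨ht'.1.le, ht'.2⟩
    refine (hL (w t, wd t) (x t, xd t) (norm_prod_le_iff.2 ⟨hwM t htI, hwdM t htI⟩)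
      (norm_prod_le_iff.2 ⟨hxM t htI, hxdM t htI⟩) _).trans ?_
    refine mul_le_mul_of_nonneg_left ?_ hL0
    have h0 := hdle t htI
    refine norm_prod_le_iff.2 ⟨?_, ?_⟩
    · simpa using by linarith [(norm_nonneg _).trans h0]
    · simpa using by linarith [norm_nonneg (x t - w t)]
  rw [intervalIntegral.integral_const_mul, intervalIntegral.integral_add hei' hdi,
    intervalIntegral.integral_sub hli hki, hftc] at hdiff
  have e : x t₁ - w t₁ = (x t₀ - w t₀) - (w t₁ - w t₀ - ∫ t in t₀..t₁, F ((w t, wd t), Ω * t))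
      + (x t₁ - x t₀ - ∫ t in t₀..t₁, F ((w t, wd t), Ω * t)) := by abel
  rw [e]
  refine (norm_add_le _ _).trans ?_
  have := norm_sub_le (x t₀ - w t₀) (w t₁ - w t₀ - ∫ t in t₀..t₁, F ((w t, wd t), Ω * t))
  linarith

theorem avg_bounds [ProperSpace E] (hF : ContDiff ℝ 2 F) {b : ((E × E) × E) × ℝ → E}
    {c : (E × E) × E → E} (hb : ContDiff ℝ 1 b) (hc : ContDiff ℝ 1 c) (M : ℝ) :
    ∃ B, 0 ≤ B ∧ ∀ s, ‖s‖ ≤ M → ‖avg (residual F Prod.fst b c) s‖ ≤ B := by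
  have hr := contDiff_avg (contDiff_residual hF contDiff_fst hb hc)
  have hp : PeriodicInAngle fun q : ((E × E) × E) × ℝ => avg (residual F Prod.fst b c) q.1 :=
    fun _ _ => rfl
  obtain ⟨B, hB0, hB⟩ := hp.exists_bound (hr.continuous.comp continuous_fst) M
  exact ⟨B, hB0, fun s hs => hB s hs 0⟩

/-- On [0, τ] the delayed values of x and X agree exactly. After τ the error in the delayed argument
is x - w at the earlier time t - τ, so it feeds into the same Grönwall inequality and no induction
over delay intervals is needed. -/
theorem exists_error_bound [ProperSpace E] (hF : ContDiff ℝ 2 F) (hFp : PeriodicInAngle F)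
    (hτ : 0 < τ) (hφ : ∀ t ∈ Ico (-τ) 0, HasDerivWithinAt φ (φ' t) (Ici t) t) {M Lφ : ℝ}
    (hM0 : 0 ≤ M) (hLφ0 : 0 ≤ Lφ) (hφM : ∀ t ∈ Icc (-τ) 0, ‖φ' t‖ ≤ M)
    (hLφ : ∀ s ∈ Icc (-τ) 0, ∀ t ∈ Icc (-τ) 0, s ≤ t → ‖φ' t - φ' s‖ ≤ Lφ * (t - s))
    (hT : 0 ≤ T) :
    ∃ C₁ C₂, 0 ≤ C₁ ∧ 0 ≤ C₂ ∧ ∀ Ω, 1 ≤ Ω → (∃ n : ℕ, Ω * τ = n * (2 * Real.pi)) →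
      ∀ T' ∈ Icc 0 T, ∀ x X : ℝ → E, IsSolutionPair F φ φ' τ Ω T' x X →
      (∀ t ∈ Icc (-τ) T', ‖x t‖ ≤ M) → (∀ t ∈ Icc (-τ) T', ‖X t‖ ≤ M) →
      ∀ t ∈ Icc 0 T', ‖x t - nearIdentity F τ Ω X t‖ ≤ C₁ / Ω ^ 2 ∧
        ‖nearIdentity F τ Ω X t - X t‖ ≤ C₂ / Ω := by
  have hF1 : ContDiff ℝ 1 F := hF.of_le (by norm_num)
  have hu := contDiff_oscPrim hF1
  have hup := periodic_oscPrim hF.continuous hFp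
  have hf0 := contDiff_avg hF1
  have hfst : ContDiff ℝ 1 (Prod.fst : (E × E) × E → E × E) := contDiff_fst
  have hb₁ : ContDiff ℝ 1 (fun _ : ((E × E) × E) × ℝ => (0 : E)) := contDiff_const
  have hc₁ : ContDiff ℝ 1 (Prod.snd : (E × E) × E → E) := contDiff_snd
  have hb₁p : PeriodicInAngle (fun _ : ((E × E) × E) × ℝ => (0 : E)) := fun _ _ => rfl
  have hb₂ : ContDiff ℝ 1 (fun q : ((E × E) × E) × ℝ => oscPrim F ((q.1.1.2, q.1.2), q.2)) :=
    hu.comp (by fun_prop)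
  have hb₂p : PeriodicInAngle (fun q : ((E × E) × E) × ℝ => oscPrim F ((q.1.1.2, q.1.2), q.2)) :=
    fun s θ => hup (s.1.2, s.2) θ
  have hc₂ : ContDiff ℝ 1 (fun s : (E × E) × E => avg F (s.1.2, s.2)) := hf0.comp (by fun_prop)
  have hf0p : PeriodicInAngle fun q : (E × E) × ℝ => avg F q.1 := fun _ _ => rfl
  obtain ⟨Bf, hBf0, hBf⟩ := hf0p.exists_bound (hf0.continuous.comp continuous_fst) M
  obtain ⟨Bu, hBu0, hBu⟩ := hup.exists_bound hu.continuous M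
  obtain ⟨B₁, hB₁0, hB₁⟩ := avg_bounds hF hb₁ hc₁ M
  obtain ⟨B₂, hB₂0, hB₂⟩ := avg_bounds hF hb₂ hc₂ M
  obtain ⟨L, hL0, hL⟩ := hFp.exists_lipschitz hF1 (M + Bu)
  -- M bounds φ' on the history, `Bf + B₁` and `Bf + B₂` bound the averaged fields, and Lφ is the
  -- Lipschitz constant of φ', which is part of the slow variable on the first interval.
  set Λ := M + Lφ + Bf + B₁ + B₂ with hΛ
  have hΛ0 : 0 ≤ Λ := by positivity
  obtain ⟨D₁, hD₁0, hD₁⟩ := exists_defect_bound hF hFp hfst hb₁ hb₁p hc₁ M Λ 0 T hΛ0 le_rfl hT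
  obtain ⟨D₂, hD₂0, hD₂⟩ := exists_defect_bound hF hFp hfst hb₂ hb₂p hc₂ M Λ (B₁ + B₂) T hΛ0
    (by positivity) hT
  refine ⟨(D₁ + D₂) * Real.exp (2 * L * T), Bu, by positivity, hBu0, ?_⟩
  rintro Ω hΩ ⟨n, hn⟩ T' hT' x X h hxM hXM
  have hΩ0 : 0 < Ω := by linarith
  have hε1 : Ω⁻¹ ≤ 1 := inv_le_one_of_one_le₀ hΩ
  have hε0 : 0 < Ω⁻¹ := inv_pos.2 hΩ0
  have hsm : ∀ {v : E} {B : ℝ}, ‖v‖ ≤ B → ‖Ω⁻¹ • v‖ ≤ B := fun {v B} hv => by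
    rw [norm_smul, Real.norm_of_nonneg hε0.le]
    exact (mul_le_of_le_one_left (norm_nonneg _) hε1).trans hv
  have hA₁ : ∀ s, ‖s‖ ≤ M → ‖avgField₁ F Ω s‖ ≤ Λ := fun s hs => by
    have h1 := hBf s.1 ((norm_fst_le s).trans hs) 0
    have h2 := hsm (hB₁ s hs)
    exact (norm_add_le _ _).trans (by simp only at h1; linarith)
  have hA₂ : ∀ s, ‖s‖ ≤ M → ‖avgField₂ F Ω s‖ ≤ Λ := fun s hs => by
    have h1 := hBf s.1 ((norm_fst_le s).trans hs) 0
    have h2 := hsm (hB₂ s hs)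
    exact (norm_add_le _ _).trans (by simp only at h1; linarith)
  have hXL := h.lipschitz_avg hτ hφ hφM hXM (by linarith) hA₁ hA₂
  set w := nearIdentity F τ Ω X with hw
  have hub : ∀ t ∈ Icc 0 T', ‖oscPrim F ((X t, X (t - τ)), Ω * t)‖ ≤ Bu := fun t ht =>
    hBu _ (norm_prod_le_iff.2 ⟨hXM _ ⟨by linarith [ht.1], ht.2⟩,
      hXM _ ⟨by linarith [ht.1], by linarith [ht.2]⟩⟩) _
  have hwX : ∀ t ∈ Icc 0 T', ‖w t - X t‖ ≤ Bu / Ω := fun t ht => by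
    rw [hw, nearIdentity, add_sub_cancel_left, norm_smul, Real.norm_of_nonneg hε0.le,
      div_eq_inv_mul]
    exact mul_le_mul_of_nonneg_left (hub t ht) hε0.le
  have hwM : ∀ t ∈ Icc 0 T', ‖w t‖ ≤ M + Bu := fun t ht =>
    (norm_add_le _ _).trans (add_le_add (hXM t ⟨by linarith [ht.1], ht.2⟩) (hsm (hub t ht)))
  have hXc : ContinuousOn X (Icc 0 T') := h.continuousOn_avg.mono (Icc_subset_Icc_left (by linarith))
  have hXdc : ContinuousOn (fun t => X (t - τ)) (Icc 0 T') :=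
    h.continuousOn_avg.comp (by fun_prop) fun t ht =>
      ⟨by linarith [ht.1], by linarith [ht.2]⟩
  have hxc : ContinuousOn x (Icc 0 T') := h.continuousOn.mono (Icc_subset_Icc_left (by linarith))
  have hxdc : ContinuousOn (fun t => x (t - τ)) (Icc 0 T') :=
    h.continuousOn.comp (by fun_prop) fun t ht => ⟨by linarith [ht.1], by linarith [ht.2]⟩
  have hwc : ContinuousOn w (Icc 0 T') :=
    hXc.add ((hu.continuous.comp_continuousOn
      ((hXc.prodMk hXdc).prodMk (by fun_prop : ContinuousOn (fun t : ℝ => Ω * t) _))).const_smul Ω⁻¹)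
  have hw0 : w 0 = x 0 := by
    have h0 : (0 : ℝ) ∈ Icc (-τ) 0 := ⟨by linarith, le_rfl⟩
    simp only [hw, nearIdentity, mul_zero, oscPrim_zero, smul_zero, add_zero]
    rw [h.history 0 h0, h.history_avg 0 h0]
  have hec : ContinuousOn (fun t => ‖x t - w t‖) (Icc 0 T') := (hxc.sub hwc).norm
  have hstep₁ : ∀ t ∈ Icc 0 T', t ≤ τ →
      ‖x t - w t‖ ≤ D₁ / Ω ^ 2 + L * ∫ s in 0..t, ‖x s - w s‖ := by
    intro t ht htτ
    have hsub : Icc 0 t ⊆ Icc 0 T' := Icc_subset_Icc_right ht.2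
    have hdef₀ := hD₁ Ω hΩ 0 t ht.1 (by linarith [ht.2, hT'.2])
      (fun s => ((X s, X (s - τ)), φ' (s - τ))) (fun s => φ' (s - τ)) ?_ ?_ ?_ ?_
    · obtain ⟨hk, hdef⟩ := hdef₀
      have := norm_sub_le_of_defect (Ω := Ω) (d := fun _ => 0) (xd := fun s => x (s - τ))
        (wd := fun s => X (s - τ) + Ω⁻¹ • 0) ht.1 hF.continuous (hxc.mono hsub) (hxdc.mono hsub)
        (hwc.mono hsub) continuousOn_const hk
        (fun s hs => h.eqn s ⟨hs.1, hs.2.trans_le ht.2⟩) hdef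
        (M := M + Bu) ?_ ?_ ?_ ?_ hL0 hL ?_
      · rw [hw0] at this
        simpa [hw0] using this
      · intro s hs
        linarith [hxM s ⟨by linarith [hs.1], hs.2.trans ht.2⟩]
      · intro s hs
        linarith [hxM (s - τ) ⟨by linarith [hs.1], by linarith [hs.2, ht.2]⟩]
      · exact fun s hs => hwM s (hsub hs)
      · intro s hs
        rw [smul_zero, add_zero]
        linarith [hXM (s - τ) ⟨by linarith [hs.1], by linarith [hs.2, ht.2]⟩]
      · intro s hs
        have h0 : s - τ ∈ Icc (-τ) 0 := ⟨by linarith [hs.1], by linarith [hs.2]⟩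
        rw [smul_zero, add_zero, h.history _ h0, h.history_avg _ h0, sub_self, norm_zero]
    · intro s hs
      refine norm_prod_le_iff.2 ⟨norm_prod_le_iff.2 ⟨hXM _ ?_, hXM _ ?_⟩, hφM _ ?_⟩ <;>
        constructor <;> linarith [hs.1, hs.2, ht.2]
    · intro s hs r hr hsr
      have e : r - τ - (s - τ) = r - s := by ring
      refine norm_prod_le_iff.2 ⟨norm_prod_le_iff.2 ⟨?_, ?_⟩, ?_⟩
      · exact hXL s ⟨by linarith [hs.1], hs.2.trans ht.2⟩ r ⟨by linarith [hr.1], hr.2.trans ht.2⟩ hsr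
      · rw [← e]
        exact hXL (s - τ) ⟨by linarith [hs.1], by linarith [hs.2, ht.2]⟩ (r - τ)
          ⟨by linarith [hr.1], by linarith [hr.2, ht.2]⟩ (by linarith)
      · rw [← e]
        refine (hLφ (s - τ) ⟨by linarith [hs.1], by linarith [hs.2, ht.2]⟩ (r - τ)
          ⟨by linarith [hr.1], by linarith [hr.2, ht.2]⟩ (by linarith)).trans ?_
        exact mul_le_mul_of_nonneg_right (by linarith) (by linarith)
    · intro s hs
      exact (h.eqn_avg₁ s ⟨hs.1, hs.2.trans_le ht.2⟩ (hs.2.trans_le htτ)).prodMk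
        (hasDerivWithinAt_comp_sub (h.hasDeriv_history hφ
          ⟨by linarith [hs.1], by linarith [hs.2]⟩))
    · intro s hs
      simp
  have hstep₂ : ∀ t ∈ Icc 0 T', τ ≤ t →
      ‖x t - w t‖ ≤ ‖x τ - w τ‖ + D₂ / Ω ^ 2
        + L * ((∫ s in τ..t, ‖x s - w s‖) + ∫ s in τ..t, ‖x (s - τ) - w (s - τ)‖) := by
    intro t ht htτ
    have hsub : Icc τ t ⊆ Icc 0 T' := Icc_subset_Icc hτ.le ht.2
    have hsub' : MapsTo (fun s => s - τ) (Icc τ t) (Icc 0 T') := fun s hs =>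
      ⟨by simp only; linarith [hs.1], by simp only; linarith [hs.2, ht.2]⟩
    -- The only use of Ωτ ∈ 2πℕ in this estimate: the oscillation of the delayed argument, taken at
    -- the current angle, is that of w(s - τ).
    have hwd : ∀ s, X (s - τ) + Ω⁻¹ • oscPrim F ((X (s - τ), X (s - 2 * τ)), Ω * s)
        = w (s - τ) := by
      intro s
      have e1 : s - τ - τ = s - 2 * τ := by ring
      have e2 : Ω * (s - τ) = Ω * s - n * (2 * Real.pi) := by rw [← hn]; ring
      have := (hup (X (s - τ), X (s - 2 * τ))).sub_nat_mul_eq n (x := Ω * s)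
      simp only [hw, nearIdentity, e1, e2]
      rw [this]
    have hdef₀ := hD₂ Ω hΩ τ t htτ (by linarith [ht.2, hT'.2])
      (fun s => ((X s, X (s - τ)), X (s - 2 * τ)))
      -- The true velocity of X(s - τ) is the averaged field of whichever regime s - τ lies in. Both
      -- differ from f₀ by Ω⁻¹ times a bounded mean, hence the constant `B₁ + B₂` in the choice of
      -- `D₂`.
      (fun s => if s - τ < τ then avgField₁ F Ω ((X (s - τ), X (s - τ - τ)), φ' (s - τ - τ))
        else avgField₂ F Ω ((X (s - τ), X (s - τ - τ)), X (s - τ - 2 * τ))) ?_ ?_ ?_ ?_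
    · obtain ⟨hk, hdef⟩ := hdef₀
      refine norm_sub_le_of_defect (Ω := Ω) (xd := fun s => x (s - τ))
        (wd := fun s => X (s - τ) + Ω⁻¹ • oscPrim F ((X (s - τ), X (s - 2 * τ)), Ω * s))
        htτ hF.continuous (hxc.mono hsub) (hxdc.mono hsub)
        (hwc.mono hsub) (hec.comp (by fun_prop) hsub') hk
        (fun s hs => h.eqn s ⟨by linarith [hs.1], hs.2.trans_le ht.2⟩) hdef
        (M := M + Bu) ?_ ?_ ?_ ?_ hL0 hL ?_
      · intro s hs
        linarith [hxM s ⟨by linarith [hs.1], hs.2.trans ht.2⟩]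
      · intro s hs
        linarith [hxM (s - τ) ⟨by linarith [hs.1], by linarith [hs.2, ht.2]⟩]
      · exact fun s hs => hwM s (hsub hs)
      · intro s hs
        rw [hwd]
        exact hwM _ (hsub' hs)
      · intro s hs
        rw [hwd]
    · intro s hs
      refine norm_prod_le_iff.2 ⟨norm_prod_le_iff.2 ⟨hXM _ ?_, hXM _ ?_⟩, hXM _ ?_⟩ <;>
        constructor <;> linarith [hs.1, hs.2, ht.2]
    · intro s hs r hr hsr
      have e : r - τ - (s - τ) = r - s := by ring
      have e' : r - 2 * τ - (s - 2 * τ) = r - s := by ring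
      refine norm_prod_le_iff.2 ⟨norm_prod_le_iff.2 ⟨?_, ?_⟩, ?_⟩
      · exact hXL s ⟨by linarith [hs.1], hs.2.trans ht.2⟩ r ⟨by linarith [hr.1], hr.2.trans ht.2⟩ hsr
      · rw [← e]
        exact hXL (s - τ) ⟨by linarith [hs.1], by linarith [hs.2, ht.2]⟩ (r - τ)
          ⟨by linarith [hr.1], by linarith [hr.2, ht.2]⟩ (by linarith)
      · rw [← e']
        exact hXL (s - 2 * τ) ⟨by linarith [hs.1], by linarith [hs.2, ht.2]⟩ (r - 2 * τ)
          ⟨by linarith [hr.1], by linarith [hr.2, ht.2]⟩ (by linarith)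
    · intro s hs
      have hm : s - τ ∈ Ico 0 T' := ⟨by linarith [hs.1], by linarith [hs.2, ht.2]⟩
      refine (h.eqn_avg₂ s ⟨by linarith [hs.1], hs.2.trans_le ht.2⟩ hs.1).prodMk
        (hasDerivWithinAt_comp_sub ?_)
      split_ifs with h1
      · exact h.eqn_avg₁ _ hm h1
      · exact h.eqn_avg₂ _ hm (not_lt.1 h1)
    · intro s hs
      have e1 : s - τ - τ = s - 2 * τ := by ring
      have hm1 : s - τ ∈ Icc (-τ) T' := ⟨by linarith [hs.1], by linarith [hs.2, ht.2]⟩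
      have hm2 : s - τ - τ ∈ Icc (-τ) T' := ⟨by linarith [hs.1], by linarith [hs.2, ht.2]⟩
      simp only
      split_ifs with h1
      · rw [avgField₁, ← e1, add_sub_cancel_left, norm_smul, Real.norm_of_nonneg hε0.le,
          div_eq_inv_mul]
        refine mul_le_mul_of_nonneg_left ?_ hε0.le
        refine (hB₁ _ (norm_prod_le_iff.2 ⟨norm_prod_le_iff.2 ⟨hXM _ hm1, hXM _ hm2⟩, hφM _
          ⟨by linarith [hs.1], by linarith⟩⟩)).trans (by linarith)
      · rw [avgField₂, ← e1, add_sub_cancel_left, norm_smul, Real.norm_of_nonneg hε0.le,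
          div_eq_inv_mul]
        refine mul_le_mul_of_nonneg_left ?_ hε0.le
        refine (hB₂ _ (norm_prod_le_iff.2 ⟨norm_prod_le_iff.2 ⟨hXM _ hm1, hXM _ hm2⟩, hXM _
          ⟨by linarith [hs.1], by linarith [hs.2, ht.2]⟩⟩)).trans
          (by linarith)
  have hei : ∀ a ∈ Icc 0 T', ∀ b ∈ Icc 0 T',
      IntervalIntegrable (fun s => ‖x s - w s‖) volume a b := fun a ha b hb =>
    (hec.mono (uIcc_subset_Icc ha hb)).intervalIntegrable
  have hnn : ∀ a b : ℝ, a ≤ b → 0 ≤ ∫ s in a..b, ‖x s - w s‖ := fun a b hab =>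
    intervalIntegral.integral_nonneg hab fun _ _ => norm_nonneg _
  have h0T : (0 : ℝ) ∈ Icc 0 T' := ⟨le_rfl, hT'.1⟩
  -- The factor 2 covers the current and the delayed argument: after the shift by τ, the delayed
  -- integral is over [0, t - τ] ⊆ [0, t].
  have hgron : ∀ t ∈ Icc 0 T',
      ‖x t - w t‖ ≤ (D₁ + D₂) / Ω ^ 2 + 2 * L * ∫ s in 0..t, ‖x s - w s‖ := by
    intro t ht
    have hD₁' : 0 ≤ D₁ / Ω ^ 2 := by positivity
    have hD₂' : 0 ≤ D₂ / Ω ^ 2 := by positivity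
    rw [add_div]
    have hI := mul_nonneg hL0 (hnn 0 t ht.1)
    rcases le_total t τ with htτ | htτ
    · linarith [hstep₁ t ht htτ]
    · have hτT : τ ∈ Icc 0 T' := ⟨hτ.le, htτ.trans ht.2⟩
      have hdT : t - τ ∈ Icc 0 T' := ⟨by linarith, by linarith [ht.2]⟩
      have s1 := hstep₁ τ hτT le_rfl
      have s2 := hstep₂ t ht htτ
      have i1 := intervalIntegral.integral_add_adjacent_intervals (hei 0 h0T τ hτT) (hei τ hτT t ht)
      have i2 := intervalIntegral.integral_add_adjacent_intervals (hei 0 h0T _ hdT) (hei _ hdT t ht)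
      have i3 := intervalIntegral.integral_comp_sub_right (a := τ) (b := t)
        (fun s => ‖x s - w s‖) τ
      simp only [sub_self] at i3
      rw [i3] at s2
      have i4 := mul_nonneg hL0 (hnn (t - τ) t (by linarith))
      have i1' := congrArg (L * ·) i1
      have i2' := congrArg (L * ·) i2
      simp only [mul_add] at i1' i2' s2
      linarith
  intro t ht
  refine ⟨?_, hwX t ht⟩
  refine (le_mul_exp_of_le_add_integral (by positivity) hec hgron t ht).trans ?_
  rw [sub_zero, div_mul_eq_mul_div]
  gcongr
  exact ht.2.trans hT'.2

/-- At a first time r with h(r) ≥ M, continuity gives h ≤ M on [0, r], and `hb` then forces h(r) ≤ m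
< M, a contradiction. -/
theorem le_of_bootstrap {h : ℝ → ℝ} {T m M : ℝ} (hc : ContinuousOn h (Icc 0 T)) (hmM : m < M)
    (h0 : 0 ≤ T → h 0 ≤ m)
    (hb : ∀ t ∈ Icc 0 T, (∀ s ∈ Icc 0 t, h s ≤ M) → h t ≤ m) : ∀ t ∈ Icc 0 T, h t ≤ m := by
  intro t ht
  refine hb t ht ?_
  by_contra! hcon
  obtain ⟨s, hs, hsM⟩ := hcon
  have hst : Icc 0 s ⊆ Icc 0 T := Icc_subset_Icc_right (hs.2.trans ht.2)
  have hK : IsCompact (Icc 0 s ∩ h ⁻¹' Ici M) :=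
    isCompact_Icc.of_isClosed_subset ((hc.mono hst).preimage_isClosed_of_isClosed isClosed_Icc
      isClosed_Ici) inter_subset_left
  obtain ⟨r, ⟨hr, hrM⟩, hrmin⟩ := hK.exists_isLeast ⟨s, ⟨hs.1, le_rfl⟩, hsM.le⟩
  have hrle : h r ≤ m := by
    refine hb r (hst hr) fun q hq => ?_
    by_contra! hqM
    obtain ⟨v, hv, hvM⟩ := intermediate_value_Icc hq.1
      (hc.mono ((Icc_subset_Icc_right (hq.2.trans hr.2)).trans hst))
      (show M ∈ Icc (h 0) (h q) from ⟨(h0 (ht.1.trans ht.2)).trans hmM.le, hqM.le⟩)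
    have hrv := hrmin ⟨⟨hv.1, hv.2.trans (hq.2.trans hr.2)⟩, hvM.ge⟩
    have hvq : v = q := le_antisymm hv.2 (hq.2.trans hrv)
    rw [hvq] at hvM
    linarith
  exact absurd (show M ≤ h r from hrM) (by linarith)

theorem exists_stroboscopic_error_bound [ProperSpace E] (hF : ContDiff ℝ 2 F)
    (hFp : PeriodicInAngle F) (hτ : 0 < τ)
    (hφ : ∀ t ∈ Ico (-τ) 0, HasDerivWithinAt φ (φ' t) (Ici t) t) {Bφ Bφ' Lφ : ℝ}
    (hLφ0 : 0 ≤ Lφ) (hφB : ∀ t ∈ Icc (-τ) 0, ‖φ t‖ ≤ Bφ)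
    (hφM : ∀ t ∈ Icc (-τ) 0, ‖φ' t‖ ≤ Bφ')
    (hLφ : ∀ s ∈ Icc (-τ) 0, ∀ t ∈ Icc (-τ) 0, s ≤ t → ‖φ' t - φ' s‖ ≤ Lφ * (t - s))
    (hT : 0 ≤ T) (R : ℝ) :
    ∃ C Ω₀, 0 < Ω₀ ∧ ∀ Ω, Ω₀ ≤ Ω → (∃ n : ℕ, τ = n * (2 * Real.pi / Ω)) →
      ∀ x X : ℝ → E, IsSolutionPair F φ φ' τ Ω T x X →
      ((∀ t ∈ Icc 0 T, ‖x t‖ ≤ R) ∨ (∀ t ∈ Icc 0 T, ‖X t‖ ≤ R)) →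
      ∀ m : ℕ, m * (2 * Real.pi / Ω) ≤ T →
        ‖x (m * (2 * Real.pi / Ω)) - X (m * (2 * Real.pi / Ω))‖ ≤ C / Ω ^ 2 := by
  -- The summand 1 is room for x - X: if one solution is bounded by R and they differ by at most 1,
  -- both are bounded by `m₀`. The error estimate is applied with the larger bound `m₀ + 1`, as the
  -- bootstrap requires.
  set m₀ := max R (max Bφ Bφ') + 1 with hm₀
  have hR : R ≤ max R (max Bφ Bφ') := le_max_left _ _
  have hBφ : Bφ ≤ max R (max Bφ Bφ') := (le_max_left _ _).trans (le_max_right _ _)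
  have hBφ' : Bφ' ≤ max R (max Bφ Bφ') := (le_max_right _ _).trans (le_max_right _ _)
  have h0mem : (0 : ℝ) ∈ Icc (-τ) 0 := ⟨by linarith, le_rfl⟩
  have hBφ0 : 0 ≤ Bφ := (norm_nonneg _).trans (hφB 0 h0mem)
  obtain ⟨C₁, C₂, hC₁, hC₂, hmain⟩ := exists_error_bound (T := T) (M := m₀ + 1) hF hFp hτ hφ
    (by linarith) hLφ0 (fun t ht => (hφM t ht).trans (by linarith)) hLφ hT
  -- This threshold gives Ω ≥ 1 and C₁/Ω² + C₂/Ω ≤ 1, hence the distance 1 used in the bootstrap.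
  refine ⟨C₁, C₁ + C₂ + 1, by positivity, ?_⟩
  rintro Ω hΩ ⟨n, hn⟩ x X h hbd
  have hΩ1 : 1 ≤ Ω := by linarith
  have hΩ0 : 0 < Ω := by linarith
  have hn' : Ω * τ = n * (2 * Real.pi) := by rw [hn]; field_simp
  have hclose : C₁ / Ω ^ 2 + C₂ / Ω ≤ 1 := by
    have : C₁ / Ω ^ 2 ≤ C₁ / Ω := by gcongr; nlinarith
    have h2 : C₁ / Ω + C₂ / Ω ≤ 1 := by rw [← add_div, div_le_one hΩ0]; linarith
    linarith
  have hsub : Icc 0 T ⊆ Icc (-τ) T := Icc_subset_Icc_left (by linarith)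
  have hext : ∀ T' ∈ Icc 0 T, (∀ s ∈ Icc 0 T', max ‖x s‖ ‖X s‖ ≤ m₀ + 1) →
      ∀ t ∈ Icc 0 T', ‖x t - nearIdentity F τ Ω X t‖ ≤ C₁ / Ω ^ 2 ∧
        ‖nearIdentity F τ Ω X t - X t‖ ≤ C₂ / Ω := by
    intro T' hT' hs
    refine hmain Ω hΩ1 ⟨n, hn'⟩ T' hT' x X (h.mono hT'.2) ?_ ?_
    · intro t ht
      rcases le_total t 0 with h0 | h0
      · rw [h.history t ⟨ht.1, h0⟩]
        linarith [hφB t ⟨ht.1, h0⟩]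
      · exact (le_max_left _ _).trans (hs t ⟨h0, ht.2⟩)
    · intro t ht
      rcases le_total t 0 with h0 | h0
      · rw [h.history_avg t ⟨ht.1, h0⟩]
        linarith [hφB t ⟨ht.1, h0⟩]
      · exact (le_max_right _ _).trans (hs t ⟨h0, ht.2⟩)
  have hboot : ∀ t ∈ Icc 0 T, max ‖x t‖ ‖X t‖ ≤ m₀ := by
    refine le_of_bootstrap (M := m₀ + 1)
      ((h.continuousOn.mono hsub).norm.sup (h.continuousOn_avg.mono hsub).norm) (by linarith) ?_ ?_
    · intro _
      rw [h.history 0 h0mem, h.history_avg 0 h0mem, max_self]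
      linarith [hφB 0 h0mem]
    · intro t ht hs
      obtain ⟨e1, e2⟩ := hext t ht hs t ⟨ht.1, le_rfl⟩
      have e3 : ‖x t - X t‖ ≤ 1 := by
        have := norm_sub_le_norm_sub_add_norm_sub (x t) (nearIdentity F τ Ω X t) (X t)
        linarith
      have e4 := norm_sub_norm_le (x t) (X t)
      have e5 := norm_sub_norm_le (X t) (x t)
      rw [norm_sub_rev] at e5
      rcases hbd with hb | hb <;> have := hb t ht <;> refine max_le ?_ ?_ <;> linarith
  intro m hm
  have ht : m * (2 * Real.pi / Ω) ∈ Icc 0 T := ⟨by positivity, hm⟩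
  have := (hext T ⟨hT, le_rfl⟩ (fun s hs => (hboot s hs).trans (by linarith)) _ ht).1
  have hz : nearIdentity F τ Ω X (m * (2 * Real.pi / Ω)) = X (m * (2 * Real.pi / Ω)) := by
    have e : Ω * (m * (2 * Real.pi / Ω)) = m * (2 * Real.pi) := by field_simp
    have hp := (periodic_oscPrim hF.continuous hFp
      (X (m * (2 * Real.pi / Ω)), X (m * (2 * Real.pi / Ω) - τ))).nat_mul_eq m
    simp only [oscPrim_zero] at hp
    rw [nearIdentity, e, hp, smul_zero, add_zero]
  rwa [hz] at this

end ErrorBound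

/-! ### Fourier coefficients of oscillatory primitives and a Parseval formula -/

section Fourier

/-- The primitive of the oscillatory part of `g` that vanishes at `0`. -/
def oscInt (g : ℝ → ℂ) (θ : ℝ) : ℂ := ∫ s in 0..θ, (g s - periodMean g)

/-- The `k`-th Fourier coefficient on `[0, 2π]`. -/
abbrev fCoeff (g : ℝ → ℂ) (k : ℤ) : ℂ := fourierCoeffOn Real.two_pi_pos g k

theorem fCoeff_zero (g : ℝ → ℂ) : fCoeff g 0 = periodMean g := by
  rw [fCoeff, fourierCoeffOn_eq_integral, periodMean]
  simp

theorem hasDerivAt_oscInt {g : ℝ → ℂ} (hg : Continuous g) (θ : ℝ) :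
    HasDerivAt (oscInt g) (g θ - periodMean g) θ :=
  ((hg.sub continuous_const).integral_hasStrictDerivAt 0 θ).hasDerivAt

theorem continuous_oscInt {g : ℝ → ℂ} (hg : Continuous g) : Continuous (oscInt g) :=
  continuous_iff_continuousAt.2 fun θ => (hasDerivAt_oscInt hg θ).continuousAt

theorem oscInt_zero (g : ℝ → ℂ) : oscInt g 0 = 0 := by simp [oscInt]

theorem oscInt_two_pi {g : ℝ → ℂ} (hg : Continuous g) : oscInt g (2 * Real.pi) = 0 := by
  rw [oscInt, intervalIntegral.integral_sub (hg.intervalIntegrable _ _) intervalIntegrable_const,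
    intervalIntegral.integral_const, sub_zero, periodMean, smul_inv_smul₀ Real.two_pi_pos.ne',
    sub_self]

theorem fCoeff_eq_of_hasDerivAt {g g' : ℝ → ℂ} {k : ℤ} (hk : k ≠ 0)
    (hg : ∀ θ, HasDerivAt g (g' θ) θ) (hg' : Continuous g') (hper : g (2 * Real.pi) = g 0) :
    fCoeff g k = -(Complex.I / k) * fCoeff g' k := by
  have h := fourierCoeffOn_of_hasDerivAt Real.two_pi_pos hk (f := g) (f' := g')
    (fun θ _ => hg θ) (hg'.intervalIntegrable _ _)
  rw [fCoeff, h, hper]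
  have hpi : (Real.pi : ℂ) ≠ 0 := Complex.ofReal_ne_zero.2 Real.pi_ne_zero
  have hk' : (k : ℂ) ≠ 0 := Int.cast_ne_zero.2 hk
  push_cast
  field_simp
  rw [Complex.I_sq]
  ring

theorem fCoeff_sub_const {g : ℝ → ℂ} (hg : Continuous g) (c : ℂ) {k : ℤ} (hk : k ≠ 0) :
    fCoeff (fun θ => g θ - c) k = fCoeff g k := by
  have h0 : fCoeff (fun _ => c) k = 0 := by
    rw [fCoeff_eq_of_hasDerivAt hk (fun θ => hasDerivAt_const θ c) continuous_const rfl,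
      fCoeff, fourierCoeffOn_eq_integral]
    simp
  have hf : Continuous fun x : ℝ => fourier (-k) (x : AddCircle (2 * Real.pi - 0)) :=
    (map_continuous (fourier (-k))).comp (AddCircle.continuous_mk' _)
  have h1 : fCoeff (fun θ => g θ - c) k = fCoeff g k - fCoeff (fun _ => c) k := by
    have i1 : IntervalIntegrable (fun x : ℝ => fourier (-k) (x : AddCircle (2 * Real.pi - 0)) • g x)
        volume 0 (2 * Real.pi) := (hf.smul hg).intervalIntegrable _ _
    have i2 : IntervalIntegrable (fun x : ℝ => fourier (-k) (x : AddCircle (2 * Real.pi - 0)) • c)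
        volume 0 (2 * Real.pi) := (hf.smul continuous_const).intervalIntegrable _ _
    simp only [fCoeff, fourierCoeffOn_eq_integral, smul_sub]
    rw [intervalIntegral.integral_sub i1 i2, smul_sub]
  rw [h1, h0, sub_zero]

theorem fCoeff_oscInt {g : ℝ → ℂ} (hg : Continuous g) {k : ℤ} (hk : k ≠ 0) :
    fCoeff (oscInt g) k = -(Complex.I / k) * fCoeff g k := by
  rw [fCoeff_eq_of_hasDerivAt hk (hasDerivAt_oscInt hg) (hg.sub continuous_const)
    (by rw [oscInt_zero, oscInt_two_pi hg]), fCoeff_sub_const hg _ hk]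

theorem norm_fCoeff_le {g : ℝ → ℂ} (hg : Continuous g) : ∃ B, 0 ≤ B ∧ ∀ k, ‖fCoeff g k‖ ≤ B := by
  obtain ⟨B, hB⟩ := (isCompact_Icc (a := (0 : ℝ)) (b := 2 * Real.pi)).exists_bound_of_continuousOn
    hg.continuousOn
  refine ⟨B, (norm_nonneg _).trans (hB 0 ⟨le_rfl, Real.two_pi_pos.le⟩), fun k => ?_⟩
  rw [fCoeff, fourierCoeffOn_eq_integral, norm_smul, sub_zero,
    Real.norm_of_nonneg (by positivity), one_div, inv_mul_le_iff₀ Real.two_pi_pos, mul_comm _ B]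
  refine (intervalIntegral.norm_integral_le_of_norm_le_const (C := B) fun θ hθ => ?_).trans_eq ?_
  · rw [uIoc_of_le Real.two_pi_pos.le] at hθ
    rw [norm_smul, fourier_apply, Circle.norm_coe, one_mul]
    exact hB θ ⟨hθ.1.le, hθ.2⟩
  · rw [sub_zero, abs_of_pos Real.two_pi_pos]

/-- Two integrations by parts, one for the primitive and one for g itself, give decay of order 1/k².
-/
theorem summable_fCoeff_oscInt {g : ℝ → ℂ} (hg : ContDiff ℝ 1 g)
    (hper : Function.Periodic g (2 * Real.pi)) : Summable (fCoeff (oscInt g)) := by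
  have hg' : Continuous (deriv g) := hg.continuous_deriv le_rfl
  obtain ⟨B, hB0, hB⟩ := norm_fCoeff_le hg'
  have hs : Summable fun k : ℤ => B * (1 / (k : ℝ) ^ 2) :=
    (Real.summable_one_div_int_pow.2 one_lt_two).mul_left B
  refine Summable.of_norm_bounded_eventually hs ?_
  have h0 : ∀ᶠ k : ℤ in cofinite, k ≠ 0 := (Set.finite_singleton (0 : ℤ)).eventually_cofinite_notMem
  filter_upwards [h0] with k hk
  rw [fCoeff_oscInt hg.continuous hk, fCoeff_eq_of_hasDerivAt hk
    (fun θ => (hg.differentiable one_ne_zero θ).hasDerivAt) hg' (by simpa using hper 0)]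
  simp only [norm_mul, norm_neg, norm_div, Complex.norm_I, Complex.norm_intCast]
  have : 1 / |(k : ℝ)| * (1 / |(k : ℝ)| * ‖fCoeff (deriv g) k‖)
      = ‖fCoeff (deriv g) k‖ * (1 / (k : ℝ) ^ 2) := by
    rw [← sq_abs (k : ℝ)]; ring
  rw [this]
  exact mul_le_mul_of_nonneg_right (hB k) (by positivity)

theorem hasSum_fCoeff_mul_fourier {U : ℝ → ℂ} (hU : Continuous U)
    (h0 : U 0 = U (2 * Real.pi)) (hs : Summable (fCoeff U)) {θ : ℝ}
    (hθ : θ ∈ Ico 0 (2 * Real.pi)) :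
    HasSum (fun k => fCoeff U k * fourier k (θ : AddCircle (2 * Real.pi))) (U θ) := by
  have : Fact (0 < 2 * Real.pi) := ⟨Real.two_pi_pos⟩
  let Uc : C(AddCircle (2 * Real.pi), ℂ) := ⟨AddCircle.liftIco (2 * Real.pi) 0 U,
    AddCircle.liftIco_continuous (by simpa using h0) hU.continuousOn⟩
  have hco : ∀ k, fourierCoeff Uc k = fCoeff U k := fun k => by
    rw [show (Uc : AddCircle (2 * Real.pi) → ℂ) = AddCircle.liftIco (2 * Real.pi) 0 U from rfl,
      fourierCoeff_liftIco_eq, fCoeff]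
    congr 1
    simp
  have := has_pointwise_sum_fourier_series_of_summable (f := Uc)
    (by simpa only [funext hco] using hs) (θ : AddCircle (2 * Real.pi))
  simp only [hco, smul_eq_mul] at this
  convert! this using 1
  exact (AddCircle.liftIco_coe_apply (by simpa using hθ)).symm

theorem hasSum_ne_zero {a : ℤ → ℂ} {s : ℂ} (h : HasSum a s) :
    HasSum (fun k : {k : ℤ // k ≠ 0} => a k) (s - a 0) := by
  have h1 := h.sub (hasSum_pi_single (0 : ℤ) (a 0))
  have h2 : (fun k => a k - Pi.single (M := fun _ => ℂ) (0 : ℤ) (a 0) k) = {k : ℤ | k ≠ 0}.indicator a := by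
    funext k
    by_cases hk : k = 0 <;> simp [hk]
  rw [h2] at h1
  exact hasSum_subtype_iff_indicator.2 h1

/-- The Fourier series of the primitive is evaluated at 0, where the primitive vanishes: its mean is
minus the sum of the other coefficients -(i/k) ĝ(k). -/
theorem hasSum_fCoeff {g : ℝ → ℂ} (hg : ContDiff ℝ 1 g)
    (hper : Function.Periodic g (2 * Real.pi)) :
    HasSum (fun k : {k : ℤ // k ≠ 0} => Complex.I / ((k : ℤ) : ℂ) * fCoeff g k)
      (periodMean (oscInt g)) := by
  have h := hasSum_fCoeff_mul_fourier (continuous_oscInt hg.continuous)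
    (by rw [oscInt_zero, oscInt_two_pi hg.continuous]) (summable_fCoeff_oscInt hg hper)
    (θ := 0) ⟨le_rfl, Real.two_pi_pos⟩
  have h1 := (hasSum_ne_zero h).neg
  convert! h1 using 1
  · funext k
    rw [fCoeff_oscInt hg.continuous k.2]
    simp
  · rw [fCoeff_zero, oscInt_zero]
    simp

/-- Parseval's formula for A times the primitive of g. The coefficients of the primitive are
absolutely summable, so its series can be integrated termwise against A, which need only be
continuous; the k = 0 term is moved to the right. -/
theorem hasSum_fCoeff_mul_fCoeff_neg {A g : ℝ → ℂ} (hA : Continuous A) (hg : ContDiff ℝ 1 g)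
    (hper : Function.Periodic g (2 * Real.pi)) :
    HasSum (fun k : {k : ℤ // k ≠ 0} => Complex.I / ((k : ℤ) : ℂ) * (fCoeff A k * fCoeff g (-k)))
      (periodMean (fun θ => A θ * oscInt g θ) - fCoeff A 0 * periodMean (oscInt g)) := by
  have hU := continuous_oscInt hg.continuous
  have hs := summable_fCoeff_oscInt hg hper
  have hfc : ∀ k : ℤ, Continuous fun θ : ℝ => fourier k (θ : AddCircle (2 * Real.pi)) := fun k =>
    (map_continuous (fourier k)).comp (AddCircle.continuous_mk' _)
  let v : ℤ → C(ℝ, ℂ) := fun k =>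
    ⟨fun θ => A θ * (fCoeff (oscInt g) k * fourier k (θ : AddCircle (2 * Real.pi))),
      hA.mul (continuous_const.mul (hfc k))⟩
  obtain ⟨B, hB⟩ := (isCompact_Icc (a := (0 : ℝ)) (b := 2 * Real.pi)).exists_bound_of_continuousOn
    hA.continuousOn
  have hB0 : 0 ≤ B := (norm_nonneg _).trans (hB 0 ⟨le_rfl, Real.two_pi_pos.le⟩)
  have hv := intervalIntegral.hasSum_intervalIntegral_of_summable_norm (a := 0)
    (b := 2 * Real.pi) (f := v) ?_
  swap
  · refine Summable.of_nonneg_of_le (fun _ => norm_nonneg _) (fun k => ?_) (hs.norm.mul_left B)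
    refine (ContinuousMap.norm_le _ (by positivity)).2 fun θ => ?_
    have hθ : (θ : ℝ) ∈ Icc 0 (2 * Real.pi) := by
      have := θ.2
      simpa [uIcc_of_le Real.two_pi_pos.le] using this
    simp only [v, ContinuousMap.restrict_apply, ContinuousMap.coe_mk, norm_mul, fourier_apply,
      Circle.norm_coe, mul_one]
    exact mul_le_mul_of_nonneg_right (hB _ hθ) (norm_nonneg _)
  have h1 : ∫ θ in 0..(2 * Real.pi), ∑' k, v k θ = ∫ θ in 0..(2 * Real.pi), A θ * oscInt g θ := by
    refine intervalIntegral.integral_congr_Ioo_of_le Real.two_pi_pos.le fun θ hθ => ?_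
    exact ((hasSum_fCoeff_mul_fourier hU (by rw [oscInt_zero, oscInt_two_pi hg.continuous]) hs
      ⟨hθ.1.le, hθ.2⟩).mul_left (A θ)).tsum_eq
  rw [h1] at hv
  have h2 : ∀ k, (2 * Real.pi)⁻¹ • ∫ θ in 0..(2 * Real.pi), v k θ
      = fCoeff (oscInt g) k * fCoeff A (-k) := by
    intro k
    have e : ∀ θ : ℝ, v k θ = fCoeff (oscInt g) k *
        (fourier k (θ : AddCircle (2 * Real.pi)) * A θ) := fun θ => by
      simp only [v, ContinuousMap.coe_mk]; ring
    simp only [e]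
    rw [intervalIntegral.integral_const_mul, ← mul_smul_comm]
    congr 1
    rw [fCoeff, fourierCoeffOn_eq_integral]
    simp
  have h3 := hv.const_smul (2 * Real.pi)⁻¹
  simp only [h2] at h3
  -- Replacing k by -k attaches k to A and -k to g, and turns the factor -i/k into i/k.
  have h4 := hasSum_ne_zero ((Equiv.neg ℤ).hasSum_iff.2 h3)
  convert! h4 using 1
  · funext k
    have hk : -(k : ℤ) ≠ 0 := neg_ne_zero.2 k.2
    simp only [Function.comp, Equiv.neg_apply, neg_neg]
    rw [fCoeff_oscInt hg.continuous hk]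
    push_cast
    rw [div_neg]; ring
  · simp only [Function.comp, Equiv.neg_apply, neg_zero]
    rw [fCoeff_zero (oscInt g), mul_comm (fCoeff A 0)]
    rfl

end Fourier

/-! ### Summation of the matrix-vector series, coordinate by coordinate -/

section MatrixSeries

variable {D : ℕ}

theorem hasSum_oscTerm_of_coord (Ω : ℝ) {a : ℤ → Fin D → ℂ} {s : Fin D → ℂ}
    (h : ∀ i, HasSum (fun k : {k : ℤ // k ≠ 0} => Complex.I / ((k : ℤ) : ℂ) * a k i) (s i)) :
    HasSum (oscTerm Ω a) (fun i => (Ω : ℂ)⁻¹ * s i) := by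
  refine Pi.hasSum.2 fun i => ?_
  convert! (h i).mul_left (Ω : ℂ)⁻¹ using 1
  funext k
  simp only [oscTerm, Pi.smul_apply, smul_eq_mul]
  rw [← div_div]; ring

theorem hasSum_oscTerm_mulVec_const (Ω : ℝ) {A : Fin D → Fin D → ℝ → ℂ}
    {J : ℤ → Matrix (Fin D) (Fin D) ℂ} (hA : ∀ i j, ContDiff ℝ 1 (A i j))
    (hAp : ∀ i j, Function.Periodic (A i j) (2 * Real.pi))
    (hJ : ∀ k i j, J k i j = fCoeff (A i j) k) (c : Fin D → ℂ) :
    HasSum (oscTerm Ω fun k => J k *ᵥ c)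
      (fun i => (Ω : ℂ)⁻¹ * ∑ j, periodMean (oscInt (A i j)) * c j) := by
  refine hasSum_oscTerm_of_coord Ω fun i => ?_
  convert! hasSum_sum fun j (_ : j ∈ Finset.univ) =>
    (hasSum_fCoeff (hA i j) (hAp i j)).mul_right (c j) using 1
  funext k
  simp only [mulVec, dotProduct, Finset.mul_sum, hJ, mul_assoc]

theorem hasSum_oscTerm_const_mulVec (Ω : ℝ) {g : Fin D → ℝ → ℂ} {G : ℤ → Fin D → ℂ}
    (hg : ∀ j, ContDiff ℝ 1 (g j)) (hgp : ∀ j, Function.Periodic (g j) (2 * Real.pi))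
    (hG : ∀ k j, G k j = fCoeff (g j) k) (M : Matrix (Fin D) (Fin D) ℂ) :
    HasSum (oscTerm Ω fun k => M *ᵥ G k)
      (fun i => (Ω : ℂ)⁻¹ * ∑ j, M i j * periodMean (oscInt (g j))) := by
  refine hasSum_oscTerm_of_coord Ω fun i => ?_
  convert! hasSum_sum fun j (_ : j ∈ Finset.univ) =>
    (hasSum_fCoeff (hg j) (hgp j)).mul_left (M i j) using 1
  funext k
  simp only [mulVec, dotProduct, Finset.mul_sum, hG]
  exact Finset.sum_congr rfl fun j _ => by ring

theorem hasSum_oscTerm_mulVec_neg (Ω : ℝ) {A : Fin D → Fin D → ℝ → ℂ} {g : Fin D → ℝ → ℂ}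
    {J : ℤ → Matrix (Fin D) (Fin D) ℂ} {G : ℤ → Fin D → ℂ} (hA : ∀ i j, ContDiff ℝ 1 (A i j))
    (hg : ∀ j, ContDiff ℝ 1 (g j)) (hgp : ∀ j, Function.Periodic (g j) (2 * Real.pi))
    (hJ : ∀ k i j, J k i j = fCoeff (A i j) k) (hG : ∀ k j, G k j = fCoeff (g j) k) :
    HasSum (oscTerm Ω fun k => J k *ᵥ G (-k))
      (fun i => (Ω : ℂ)⁻¹ * ∑ j, (periodMean (fun θ => A i j θ * oscInt (g j) θ)
        - J 0 i j * periodMean (oscInt (g j)))) := by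
  refine hasSum_oscTerm_of_coord Ω fun i => ?_
  simp only [hJ 0]
  convert! hasSum_sum fun j (_ : j ∈ Finset.univ) =>
    hasSum_fCoeff_mul_fCoeff_neg (hA i j).continuous (hg j) (hgp j) using 1
  funext k
  simp only [mulVec, dotProduct, Finset.mul_sum, hJ, hG]

end MatrixSeries

/-! ### Complex coordinates, Jacobian entries and the mean of the residual -/

section Coordinates

variable {𝕜 : Type*} [RCLike 𝕜] [NormedAlgebra 𝕜 ℂ] {D : ℕ}

/-- The embedding of `𝕜` into `ℂ` as a real linear map. -/
def embC (𝕜 : Type*) [RCLike 𝕜] [NormedAlgebra 𝕜 ℂ] : 𝕜 →L[ℝ] ℂ where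
  toFun := algebraMap 𝕜 ℂ
  map_add' := map_add _
  map_smul' r x := map_real_smul (algebraMap 𝕜 ℂ) (algebraMapCLM 𝕜 ℂ).continuous r x
  cont := (algebraMapCLM 𝕜 ℂ).continuous

/-- The `i`-th coordinate, as a complex number. -/
def coordC (𝕜 : Type*) [RCLike 𝕜] [NormedAlgebra 𝕜 ℂ] {D : ℕ} (i : Fin D) : (Fin D → 𝕜) →L[ℝ] ℂ :=
  (embC 𝕜).comp (ContinuousLinearMap.proj i)

theorem coordC_apply (i : Fin D) (v : Fin D → 𝕜) : coordC 𝕜 i v = toC v i := rfl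

theorem coordC_smul (i : Fin D) (c : 𝕜) (v : Fin D → 𝕜) :
    coordC 𝕜 i (c • v) = algebraMap 𝕜 ℂ c * coordC 𝕜 i v := by
  simp [coordC_apply, toC]

/-- `toC` as a real linear map. -/
def toCL (𝕜 : Type*) [RCLike 𝕜] [NormedAlgebra 𝕜 ℂ] (D : ℕ) : (Fin D → 𝕜) →L[ℝ] (Fin D → ℂ) :=
  ContinuousLinearMap.pi (coordC 𝕜)

variable {F : ((Fin D → 𝕜) × (Fin D → 𝕜)) × ℝ → Fin D → 𝕜}

/-- Partial derivatives commute with multiplication by scalars of `𝕜`. -/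
theorem partialFDeriv_smul (hF : ContDiff ℝ 1 F) (hd : ∀ θ, Differentiable 𝕜 fun p => F (p, θ))
    (q : ((Fin D → 𝕜) × (Fin D → 𝕜)) × ℝ) (c : 𝕜) (v : (Fin D → 𝕜) × (Fin D → 𝕜)) :
    partialFDeriv F q (c • v) = c • partialFDeriv F q v := by
  have h1 := ((hd q.2) q.1).hasFDerivAt.restrictScalars ℝ
  have h2 : partialFDeriv F q = (fderiv 𝕜 (fun p => F (p, q.2)) q.1).restrictScalars ℝ :=
    (hasFDerivAt_partial hF q.1 q.2).unique h1
  rw [h2]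
  simp

theorem pair_eq_sum (a b : Fin D → 𝕜) : ((a, b) : (Fin D → 𝕜) × (Fin D → 𝕜)) =
    ∑ j, (a j • ((Pi.single j 1, 0) : (Fin D → 𝕜) × (Fin D → 𝕜)) +
      b j • ((0, Pi.single j 1) : (Fin D → 𝕜) × (Fin D → 𝕜))) := by
  refine Prod.ext ?_ ?_
  · simp only [Prod.fst_sum, Prod.fst_add, Prod.smul_fst, smul_zero, add_zero]
    exact pi_eq_sum_univ' a
  · simp only [Prod.snd_sum, Prod.snd_add, Prod.smul_snd, smul_zero, zero_add]
    exact pi_eq_sum_univ' b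

/-- The entry `∂ F_i / ∂ x_j` as a function of the angle. -/
def entryX (F : ((Fin D → 𝕜) × (Fin D → 𝕜)) × ℝ → Fin D → 𝕜) (q : (Fin D → 𝕜) × (Fin D → 𝕜))
    (i j : Fin D) (θ : ℝ) : ℂ := coordC 𝕜 i (partialFDeriv F (q, θ) (Pi.single j 1, 0))

/-- The entry `∂ F_i / ∂ y_j` as a function of the angle. -/
def entryY (F : ((Fin D → 𝕜) × (Fin D → 𝕜)) × ℝ → Fin D → 𝕜) (q : (Fin D → 𝕜) × (Fin D → 𝕜))
    (i j : Fin D) (θ : ℝ) : ℂ := coordC 𝕜 i (partialFDeriv F (q, θ) (0, Pi.single j 1))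

/-- The real derivative is 𝕜-linear because F is 𝕜-differentiable. For 𝕜 = ℂ this is where
holomorphy enters: D complex columns per variable describe the derivative. -/
theorem coordC_partialFDeriv (hF : ContDiff ℝ 1 F) (hd : ∀ θ, Differentiable 𝕜 fun p => F (p, θ))
    (q : (Fin D → 𝕜) × (Fin D → 𝕜)) (θ : ℝ) (i : Fin D) (a b : Fin D → 𝕜) :
    coordC 𝕜 i (partialFDeriv F (q, θ) (a, b)) =
      ∑ j, (entryX F q i j θ * toC a j + entryY F q i j θ * toC b j) := by
  rw [pair_eq_sum a b, map_sum, map_sum]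
  refine Finset.sum_congr rfl fun j _ => ?_
  rw [map_add, map_add, partialFDeriv_smul hF hd, partialFDeriv_smul hF hd, coordC_smul,
    coordC_smul, mul_comm, mul_comm (algebraMap 𝕜 ℂ (b j))]
  rfl

theorem contDiff_entry (hF : ContDiff ℝ 2 F) (q : (Fin D → 𝕜) × (Fin D → 𝕜)) (i : Fin D)
    (w : (Fin D → 𝕜) × (Fin D → 𝕜)) :
    ContDiff ℝ 1 fun θ => coordC 𝕜 i (partialFDeriv F (q, θ) w) := by
  have hA : ContDiff ℝ 1 (partialFDeriv F) := contDiff_partialFDeriv hF (by norm_num)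
  exact (coordC 𝕜 i).contDiff.comp ((hA.comp (contDiff_prodMk_right q)).clm_apply contDiff_const)

theorem periodic_entry (hFp : PeriodicInAngle F) (q : (Fin D → 𝕜) × (Fin D → 𝕜)) (i : Fin D)
    (w : (Fin D → 𝕜) × (Fin D → 𝕜)) :
    Function.Periodic (fun θ => coordC 𝕜 i (partialFDeriv F (q, θ) w)) (2 * Real.pi) := fun θ => by
  have := periodic_partialFDeriv hFp q θ
  simp only at this
  simp only [this]

section Means

variable {G G' : Type*} [NormedAddCommGroup G] [NormedSpace ℝ G] [CompleteSpace G]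
  [NormedAddCommGroup G'] [NormedSpace ℝ G'] [CompleteSpace G']

theorem map_periodMean (L : G →L[ℝ] G') {h : ℝ → G} (hh : Continuous h) :
    L (periodMean h) = periodMean fun θ => L (h θ) := by
  rw [periodMean, map_smul, ← L.intervalIntegral_comp_comm (hh.intervalIntegrable _ _)]
  rfl

theorem periodMean_add {g h : ℝ → G} (hg : Continuous g) (hh : Continuous h) :
    periodMean (fun θ => g θ + h θ) = periodMean g + periodMean h := by
  rw [periodMean, intervalIntegral.integral_add (hg.intervalIntegrable _ _)
    (hh.intervalIntegrable _ _), smul_add]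
  rfl

theorem periodMean_sub {g h : ℝ → G} (hg : Continuous g) (hh : Continuous h) :
    periodMean (fun θ => g θ - h θ) = periodMean g - periodMean h := by
  rw [periodMean, intervalIntegral.integral_sub (hg.intervalIntegrable _ _)
    (hh.intervalIntegrable _ _), smul_sub]
  rfl

theorem periodMean_sum {g : Fin D → ℝ → G} (hg : ∀ j, Continuous (g j)) :
    periodMean (fun θ => ∑ j, g j θ) = ∑ j, periodMean (g j) := by
  rw [periodMean, intervalIntegral.integral_finsetSum fun j _ => (hg j).intervalIntegrable _ _,
    Finset.smul_sum]
  rfl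

theorem periodMean_mul_const (g : ℝ → ℂ) (c : ℂ) :
    periodMean (fun θ => g θ * c) = periodMean g * c := by
  rw [periodMean, intervalIntegral.integral_mul_const, periodMean, smul_mul_assoc]

theorem oscInt_add {g h : ℝ → ℂ} (hg : Continuous g) (hh : Continuous h) (θ : ℝ) :
    oscInt (fun θ => g θ + h θ) θ = oscInt g θ + oscInt h θ := by
  have hg' : Continuous fun s => g s - periodMean g := hg.sub continuous_const
  have hh' : Continuous fun s => h s - periodMean h := hh.sub continuous_const
  rw [oscInt, periodMean_add hg hh, oscInt, oscInt, ← intervalIntegral.integral_add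
    (hg'.intervalIntegrable _ _) (hh'.intervalIntegrable _ _)]
  congr 1
  funext s
  ring

theorem oscInt_mul_const (g : ℝ → ℂ) (c : ℂ) (θ : ℝ) :
    oscInt (fun θ => g θ * c) θ = oscInt g θ * c := by
  rw [oscInt, periodMean_mul_const, oscInt, ← intervalIntegral.integral_mul_const]
  congr 1
  funext s
  ring

theorem oscInt_sum {g : Fin D → ℝ → ℂ} (hg : ∀ j, Continuous (g j)) (θ : ℝ) :
    oscInt (fun θ => ∑ j, g j θ) θ = ∑ j, oscInt (g j) θ := by
  have hg' : ∀ j, Continuous fun s => g j s - periodMean (g j) := fun j =>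
    (hg j).sub continuous_const
  simp only [oscInt]
  rw [periodMean_sum hg, ← intervalIntegral.integral_finsetSum fun j _ =>
    (hg' j).intervalIntegrable _ _]
  simp only [Finset.sum_sub_distrib]

theorem map_oscPrim {P : Type*} [NormedAddCommGroup P] {F : P × ℝ → G} (hF : Continuous F)
    (L : G →L[ℝ] ℂ) (p : P) (θ : ℝ) :
    L (oscPrim F (p, θ)) = oscInt (fun s => L (F (p, s))) θ := by
  have hc : Continuous fun s => F (p, s) := by fun_prop
  have hc' : Continuous fun s => F (p, s) - avg F p := hc.sub continuous_const
  rw [oscPrim, ← L.intervalIntegral_comp_comm (hc'.intervalIntegrable _ _), oscInt,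
    ← map_periodMean L hc]
  congr 1
  funext s
  exact map_sub L _ _

end Means

theorem coordC_oscPrim_partialFDeriv (hF : ContDiff ℝ 2 F)
    (hd : ∀ θ, Differentiable 𝕜 fun p => F (p, θ))
    (q : (Fin D → 𝕜) × (Fin D → 𝕜)) (θ : ℝ) (i : Fin D) (a b : Fin D → 𝕜) :
    coordC 𝕜 i (oscPrim (partialFDeriv F) (q, θ) (a, b)) =
      ∑ j, (oscInt (entryX F q i j) θ * toC a j + oscInt (entryY F q i j) θ * toC b j) := by
  have hF1 : ContDiff ℝ 1 F := hF.of_le (by norm_num)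
  have hA : ContDiff ℝ 1 (partialFDeriv F) := contDiff_partialFDeriv hF (by norm_num)
  have hX : ∀ j, Continuous (entryX F q i j) := fun j => (contDiff_entry hF q i _).continuous
  have hY : ∀ j, Continuous (entryY F q i j) := fun j => (contDiff_entry hF q i _).continuous
  let L : (((Fin D → 𝕜) × (Fin D → 𝕜)) →L[ℝ] (Fin D → 𝕜)) →L[ℝ] ℂ :=
    (coordC 𝕜 i).comp (ContinuousLinearMap.apply ℝ (Fin D → 𝕜) (a, b))
  have h := map_oscPrim hA.continuous L q θ
  have e : (fun s => L (partialFDeriv F (q, s))) = fun s =>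
      ∑ j, (entryX F q i j s * toC a j + entryY F q i j s * toC b j) :=
    funext fun s => coordC_partialFDeriv hF1 hd q s i a b
  have hXa : ∀ j, Continuous fun s => entryX F q i j s * toC a j := fun j =>
    (hX j).mul continuous_const
  have hYb : ∀ j, Continuous fun s => entryY F q i j s * toC b j := fun j =>
    (hY j).mul continuous_const
  have hXY : ∀ j, Continuous fun s => entryX F q i j s * toC a j + entryY F q i j s * toC b j :=
    fun j => (hXa j).add (hYb j)
  rw [e, oscInt_sum hXY] at h
  refine h.trans (Finset.sum_congr rfl fun j _ => ?_)
  rw [oscInt_add (hXa j) (hYb j), oscInt_mul_const, oscInt_mul_const]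

theorem coordC_periodMean_residual (hF : ContDiff ℝ 2 F)
    (hd : ∀ θ, Differentiable 𝕜 fun p => F (p, θ))
    (q : (Fin D → 𝕜) × (Fin D → 𝕜)) (i : Fin D) {u b : ℝ → Fin D → 𝕜} (hu : Continuous u)
    (hb : Continuous b) (a c : Fin D → 𝕜) :
    coordC 𝕜 i (periodMean fun θ => partialFDeriv F (q, θ) (u θ, b θ)
        - oscPrim (partialFDeriv F) (q, θ) (a, c)) =
      ∑ j, ((periodMean (fun θ => entryX F q i j θ * toC (u θ) j)
        + periodMean (fun θ => entryY F q i j θ * toC (b θ) j))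
        - (periodMean (oscInt (entryX F q i j)) * toC a j
          + periodMean (oscInt (entryY F q i j)) * toC c j)) := by
  have hF1 : ContDiff ℝ 1 F := hF.of_le (by norm_num)
  have hA : ContDiff ℝ 1 (partialFDeriv F) := contDiff_partialFDeriv hF (by norm_num)
  have hX : ∀ j, Continuous (entryX F q i j) := fun j => (contDiff_entry hF q i _).continuous
  have hY : ∀ j, Continuous (entryY F q i j) := fun j => (contDiff_entry hF q i _).continuous
  have hXu : ∀ j, Continuous fun θ => entryX F q i j θ * toC (u θ) j := fun j =>
    (hX j).mul ((coordC 𝕜 j).continuous.comp hu)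
  have hYb : ∀ j, Continuous fun θ => entryY F q i j θ * toC (b θ) j := fun j =>
    (hY j).mul ((coordC 𝕜 j).continuous.comp hb)
  have hXa : ∀ j, Continuous fun θ => oscInt (entryX F q i j) θ * toC a j := fun j =>
    (continuous_oscInt (hX j)).mul continuous_const
  have hYc : ∀ j, Continuous fun θ => oscInt (entryY F q i j) θ * toC c j := fun j =>
    (continuous_oscInt (hY j)).mul continuous_const
  have h1 : Continuous fun θ => partialFDeriv F (q, θ) (u θ, b θ) :=
    (hA.continuous.comp (Continuous.prodMk_right q)).clm_apply (hu.prodMk hb)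
  have h2 : Continuous fun θ => oscPrim (partialFDeriv F) (q, θ) (a, c) :=
    ((contDiff_oscPrim hA).continuous.comp (Continuous.prodMk_right q)).clm_apply continuous_const
  have h3 : Continuous fun θ => partialFDeriv F (q, θ) (u θ, b θ)
      - oscPrim (partialFDeriv F) (q, θ) (a, c) := h1.sub h2
  have h4 : ∀ j, Continuous fun θ => entryX F q i j θ * toC (u θ) j
      + entryY F q i j θ * toC (b θ) j := fun j => (hXu j).add (hYb j)
  have h5 : ∀ j, Continuous fun θ => oscInt (entryX F q i j) θ * toC a j
      + oscInt (entryY F q i j) θ * toC c j := fun j => (hXa j).add (hYc j)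
  have h6 : ∀ j, Continuous fun θ => (entryX F q i j θ * toC (u θ) j
      + entryY F q i j θ * toC (b θ) j) - (oscInt (entryX F q i j) θ * toC a j
      + oscInt (entryY F q i j) θ * toC c j) := fun j => (h4 j).sub (h5 j)
  rw [map_periodMean _ h3]
  simp only [map_sub, coordC_partialFDeriv hF1 hd, coordC_oscPrim_partialFDeriv hF hd,
    ← Finset.sum_sub_distrib]
  rw [periodMean_sum h6]
  refine Finset.sum_congr rfl fun j _ => ?_
  rw [periodMean_sub (h4 j) (h5 j), periodMean_add (hXu j) (hYb j),
    periodMean_add (hXa j) (hYc j), periodMean_mul_const, periodMean_mul_const]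

/-- Fourier coefficients of a vector valued function of a slow variable. -/
theorem hasFDerivAt_fourierCoeffOn (hF : ContDiff ℝ 1 F) (k : ℤ)
    (q : (Fin D → 𝕜) × (Fin D → 𝕜)) :
    ∃ L : ((Fin D → 𝕜) × (Fin D → 𝕜)) →L[ℝ] (Fin D → ℂ),
      HasFDerivAt (fun q => fourierCoeffOn Real.two_pi_pos (fun θ => toC (F (q, θ))) k) L q ∧
      ∀ v i, L v i = fCoeff (fun θ => coordC 𝕜 i (partialFDeriv F (q, θ) v)) k := by
  let e : ℝ → ℂ := fun θ => fourier (-k) (θ : AddCircle (2 * Real.pi - 0))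
  have he : ContDiff ℝ 1 e := by
    have : e = fun θ : ℝ => Complex.exp (2 * Real.pi * Complex.I * ((-k : ℤ) : ℂ) * (θ : ℂ)
        / ((2 * Real.pi - 0 : ℝ) : ℂ)) := funext fun θ => fourier_coe_apply
    rw [this]
    have h0 : ContDiff ℝ 1 fun θ : ℝ => (θ : ℂ) := Complex.ofRealCLM.contDiff
    exact ((contDiff_const.mul h0).div_const _).cexp
  let H : ((Fin D → 𝕜) × (Fin D → 𝕜)) × ℝ → Fin D → ℂ := fun q => e q.2 • toCL 𝕜 D (F q)
  have hH : ContDiff ℝ 1 H := (he.comp contDiff_snd).smul ((toCL 𝕜 D).contDiff.comp hF)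
  have hpH : ∀ q v, partialFDeriv H q v = e q.2 • toC (partialFDeriv F q v) := fun q v => by
    have h1 := ((toCL 𝕜 D).hasFDerivAt.comp q.1 (hasFDerivAt_partial hF q.1 q.2)).const_smul
      (e q.2)
    rw [(hasFDerivAt_partial hH q.1 q.2).unique h1]
    rfl
  refine ⟨(1 / (2 * Real.pi - 0)) • ∫ θ in 0..(2 * Real.pi), partialFDeriv H (q, θ), ?_, ?_⟩
  · have h := (hasFDerivAt_parametric_integral hH 0 (2 * Real.pi) q).const_smul
      (1 / (2 * Real.pi - 0))
    refine h.congr_of_eventuallyEq (Eventually.of_forall fun q => ?_)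
    exact fourierCoeffOn_eq_integral _ _ _
  · intro v i
    have hc : Continuous fun θ => partialFDeriv H (q, θ) :=
      ((contDiff_partialFDeriv (m := 0) hH (by simp)).continuous).comp (Continuous.prodMk_right q)
    let Λ : (((Fin D → 𝕜) × (Fin D → 𝕜)) →L[ℝ] (Fin D → ℂ)) →L[ℝ] ℂ :=
      (ContinuousLinearMap.proj i).comp (ContinuousLinearMap.apply ℝ (Fin D → ℂ) v)
    have h1 : Λ (∫ θ in 0..(2 * Real.pi), partialFDeriv H (q, θ)) =
        ∫ θ in 0..(2 * Real.pi), Λ (partialFDeriv H (q, θ)) :=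
      (Λ.intervalIntegral_comp_comm (hc.intervalIntegrable _ _)).symm
    rw [fCoeff, fourierCoeffOn_eq_integral]
    refine (congrArg ((1 / (2 * Real.pi - 0)) • ·) h1).trans ?_
    congr 1
    refine intervalIntegral.integral_congr fun θ _ => ?_
    exact congrFun (hpH (q, θ) v) i

end Coordinates

/-! ### Identification of the series with the averaged fields -/

section AveragedEquation

variable {𝕜 : Type*} [RCLike 𝕜] [NormedAlgebra 𝕜 ℂ] {D : ℕ}

/-- The vector field with slow variables and angle collected in a pair. -/
def uncurryField (f : (Fin D → 𝕜) → (Fin D → 𝕜) → ℝ → (Fin D → 𝕜))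
    (q : ((Fin D → 𝕜) × (Fin D → 𝕜)) × ℝ) : Fin D → 𝕜 := f q.1.1 q.1.2 q.2

/-- The `j`-th component as a complex function of the angle. -/
def component (F : ((Fin D → 𝕜) × (Fin D → 𝕜)) × ℝ → Fin D → 𝕜)
    (q : (Fin D → 𝕜) × (Fin D → 𝕜)) (j : Fin D) (θ : ℝ) : ℂ := coordC 𝕜 j (F (q, θ))

variable {f : (Fin D → 𝕜) → (Fin D → 𝕜) → ℝ → (Fin D → 𝕜)}

theorem fourierCo_apply (hF : Continuous (uncurryField f)) (k : ℤ) (x y : Fin D → 𝕜) (j : Fin D) :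
    fourierCo f k x y j = fCoeff (component (uncurryField f) (x, y) j) k := by
  have hf : Continuous fun θ : ℝ => fourier (-k) (θ : AddCircle (2 * Real.pi - 0)) :=
    (map_continuous (fourier (-k))).comp (AddCircle.continuous_mk' _)
  have hg : Continuous fun θ : ℝ => toC (f x y θ) :=
    (toCL 𝕜 D).continuous.comp (hF.comp (Continuous.prodMk_right (x, y)))
  have hfg : Continuous fun θ : ℝ => fourier (-k) (θ : AddCircle (2 * Real.pi - 0)) •
    toC (f x y θ) := hf.smul hg
  rw [fourierCo, fCoeff, fourierCoeffOn_eq_integral, fourierCoeffOn_eq_integral]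
  exact congrArg ((1 / (2 * Real.pi - 0)) • ·)
    ((ContinuousLinearMap.proj (R := ℝ) (φ := fun _ : Fin D => ℂ) j).intervalIntegral_comp_comm
      (hfg.intervalIntegrable (μ := volume) 0 (2 * Real.pi))).symm

/-- Differentiation of Fourier coefficients over the field `𝕜`. -/
theorem exists_hasFDerivAt_fourierCoeffOn {F : ((Fin D → 𝕜) × (Fin D → 𝕜)) × ℝ → Fin D → 𝕜}
    (hF : ContDiff ℝ 1 F) (hd : ∀ θ, Differentiable 𝕜 fun p => F (p, θ)) (k : ℤ)
    (q : (Fin D → 𝕜) × (Fin D → 𝕜)) :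
    ∃ L : ((Fin D → 𝕜) × (Fin D → 𝕜)) →L[𝕜] (Fin D → ℂ),
      HasFDerivAt (fun q => fourierCoeffOn Real.two_pi_pos (fun θ => toC (F (q, θ))) k) L q ∧
      ∀ v i, L v i = fCoeff (fun θ => coordC 𝕜 i (partialFDeriv F (q, θ) v)) k := by
  -- The map 𝕜 → ℂ is only known as a continuous ring homomorphism, which is enough for it to be
  -- real linear; real and 𝕜-derivatives can then be compared.
  have : IsScalarTower ℝ 𝕜 ℂ := ⟨fun r c z => by
    rw [Algebra.smul_def (R := 𝕜) (A := ℂ), Algebra.smul_def (R := 𝕜) (A := ℂ), ← smul_mul_assoc]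
    exact congrArg (· * z) ((embC 𝕜).map_smul r c)⟩
  obtain ⟨L, hL, hLv⟩ := hasFDerivAt_fourierCoeffOn hF k q
  have hsmul : ∀ (c : 𝕜) v, L (c • v) = c • L v := fun c v => by
    funext i
    rw [Pi.smul_apply, hLv, hLv, Algebra.smul_def (R := 𝕜) (A := ℂ), fCoeff, fCoeff, ← fourierCoeffOn.const_mul]
    congr 1
    funext θ
    rw [partialFDeriv_smul hF hd, coordC_smul]
  refine ⟨{ toFun := L, map_add' := L.map_add, map_smul' := hsmul, cont := L.continuous }, ?_, hLv⟩
  exact hasFDerivAt_of_restrictScalars ℝ hL rfl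

theorem jacX_apply (hF : ContDiff ℝ 1 (uncurryField f))
    (hd : ∀ θ, Differentiable 𝕜 fun p => uncurryField f (p, θ)) (k : ℤ) (x y : Fin D → 𝕜)
    (i j : Fin D) : jacX f k x y i j = fCoeff (entryX (uncurryField f) (x, y) i j) k := by
  obtain ⟨L, hL, hLv⟩ := exists_hasFDerivAt_fourierCoeffOn hF hd k (x, y)
  have h : HasFDerivAt (fun x' => fourierCo f k x' y) (L.comp (ContinuousLinearMap.inl 𝕜 _ _)) x :=
    HasFDerivAt.comp (g := fun q => fourierCoeffOn Real.two_pi_pos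
      (fun θ => toC (uncurryField f (q, θ))) k) x hL (hasFDerivAt_prodMk_left (𝕜 := 𝕜) x y)
  rw [jacX, jacobian, Matrix.of_apply, h.fderiv]
  exact hLv _ i

theorem jacY_apply (hF : ContDiff ℝ 1 (uncurryField f))
    (hd : ∀ θ, Differentiable 𝕜 fun p => uncurryField f (p, θ)) (k : ℤ) (x y : Fin D → 𝕜)
    (i j : Fin D) : jacY f k x y i j = fCoeff (entryY (uncurryField f) (x, y) i j) k := by
  obtain ⟨L, hL, hLv⟩ := exists_hasFDerivAt_fourierCoeffOn hF hd k (x, y)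
  have h : HasFDerivAt (fun y' => fourierCo f k x y') (L.comp (ContinuousLinearMap.inr 𝕜 _ _)) y :=
    HasFDerivAt.comp (g := fun q => fourierCoeffOn Real.two_pi_pos
      (fun θ => toC (uncurryField f (q, θ))) k) y hL (hasFDerivAt_prodMk_right (𝕜 := 𝕜) x y)
  rw [jacY, jacobian, Matrix.of_apply, h.fderiv]
  exact hLv _ i

theorem contDiff_component {F : ((Fin D → 𝕜) × (Fin D → 𝕜)) × ℝ → Fin D → 𝕜}
    (hF : ContDiff ℝ 1 F) (q : (Fin D → 𝕜) × (Fin D → 𝕜)) (j : Fin D) :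
    ContDiff ℝ 1 (component F q j) :=
  (coordC 𝕜 j).contDiff.comp (hF.comp (contDiff_prodMk_right q))

theorem periodic_component {F : ((Fin D → 𝕜) × (Fin D → 𝕜)) × ℝ → Fin D → 𝕜}
    (hFp : PeriodicInAngle F) (q : (Fin D → 𝕜) × (Fin D → 𝕜)) (j : Fin D) :
    Function.Periodic (component F q j) (2 * Real.pi) := fun θ =>
  congrArg (coordC 𝕜 j) (hFp q θ)

theorem toC_oscPrim {F : ((Fin D → 𝕜) × (Fin D → 𝕜)) × ℝ → Fin D → 𝕜} (hF : Continuous F)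
    (q : (Fin D → 𝕜) × (Fin D → 𝕜)) (j : Fin D) (θ : ℝ) :
    toC (oscPrim F (q, θ)) j = oscInt (component F q j) θ :=
  map_oscPrim hF (coordC 𝕜 j) q θ

theorem toC_avg (hF : Continuous (uncurryField f)) (x y : Fin D → 𝕜) :
    toC (avg (uncurryField f) (x, y)) = fourierCo f 0 x y := by
  funext j
  have hc : Continuous fun θ => uncurryField f ((x, y), θ) :=
    hF.comp (Continuous.prodMk_right (x, y))
  rw [fourierCo_apply hF, fCoeff_zero, ← coordC_apply, avg, map_periodMean _ hc]
  rfl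

theorem hasSum_mulVec_fourierCo (hF : ContDiff ℝ 2 (uncurryField f))
    (hFp : PeriodicInAngle (uncurryField f)) (Ω : ℝ) (x y : Fin D → 𝕜)
    (M : Matrix (Fin D) (Fin D) ℂ) :
    HasSum (oscTerm Ω fun k => M *ᵥ fourierCo f k x y) (fun i => (Ω : ℂ)⁻¹ *
      ∑ j, M i j * periodMean (oscInt (component (uncurryField f) (x, y) j))) :=
  hasSum_oscTerm_const_mulVec Ω (contDiff_component (hF.of_le (by norm_num)) (x, y))
    (periodic_component hFp (x, y)) (fun k j => fourierCo_apply hF.continuous k x y j) M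

theorem hasSum_jacX_mulVec_const (hF : ContDiff ℝ 2 (uncurryField f))
    (hFp : PeriodicInAngle (uncurryField f))
    (hd : ∀ θ, Differentiable 𝕜 fun p => uncurryField f (p, θ)) (Ω : ℝ) (x y : Fin D → 𝕜)
    (c : Fin D → ℂ) :
    HasSum (oscTerm Ω fun k => jacX f k x y *ᵥ c) (fun i => (Ω : ℂ)⁻¹ *
      ∑ j, periodMean (oscInt (entryX (uncurryField f) (x, y) i j)) * c j) :=
  hasSum_oscTerm_mulVec_const Ω (fun i _ => contDiff_entry hF (x, y) i _)
    (fun i _ => periodic_entry hFp (x, y) i _)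
    (fun k i j => jacX_apply (hF.of_le (by norm_num)) hd k x y i j) c

theorem hasSum_jacY_mulVec_const (hF : ContDiff ℝ 2 (uncurryField f))
    (hFp : PeriodicInAngle (uncurryField f))
    (hd : ∀ θ, Differentiable 𝕜 fun p => uncurryField f (p, θ)) (Ω : ℝ) (x y : Fin D → 𝕜)
    (c : Fin D → ℂ) :
    HasSum (oscTerm Ω fun k => jacY f k x y *ᵥ c) (fun i => (Ω : ℂ)⁻¹ *
      ∑ j, periodMean (oscInt (entryY (uncurryField f) (x, y) i j)) * c j) :=
  hasSum_oscTerm_mulVec_const Ω (fun i _ => contDiff_entry hF (x, y) i _)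
    (fun i _ => periodic_entry hFp (x, y) i _)
    (fun k i j => jacY_apply (hF.of_le (by norm_num)) hd k x y i j) c

theorem hasSum_jacX_mulVec_neg (hF : ContDiff ℝ 2 (uncurryField f))
    (hFp : PeriodicInAngle (uncurryField f))
    (hd : ∀ θ, Differentiable 𝕜 fun p => uncurryField f (p, θ)) (Ω : ℝ) (x y y' z' : Fin D → 𝕜) :
    HasSum (oscTerm Ω fun k => jacX f k x y *ᵥ fourierCo f (-k) y' z') (fun i => (Ω : ℂ)⁻¹ *
      ∑ j, (periodMean (fun θ => entryX (uncurryField f) (x, y) i j θ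
        * oscInt (component (uncurryField f) (y', z') j) θ)
        - jacX f 0 x y i j * periodMean (oscInt (component (uncurryField f) (y', z') j)))) :=
  hasSum_oscTerm_mulVec_neg Ω (fun i _ => contDiff_entry hF (x, y) i _)
    (contDiff_component (hF.of_le (by norm_num)) (y', z')) (periodic_component hFp (y', z'))
    (fun k i j => jacX_apply (hF.of_le (by norm_num)) hd k x y i j)
    (fun k j => fourierCo_apply hF.continuous k y' z' j)

theorem hasSum_jacY_mulVec_neg (hF : ContDiff ℝ 2 (uncurryField f))
    (hFp : PeriodicInAngle (uncurryField f))
    (hd : ∀ θ, Differentiable 𝕜 fun p => uncurryField f (p, θ)) (Ω : ℝ) (x y y' z' : Fin D → 𝕜) :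
    HasSum (oscTerm Ω fun k => jacY f k x y *ᵥ fourierCo f (-k) y' z') (fun i => (Ω : ℂ)⁻¹ *
      ∑ j, (periodMean (fun θ => entryY (uncurryField f) (x, y) i j θ
        * oscInt (component (uncurryField f) (y', z') j) θ)
        - jacY f 0 x y i j * periodMean (oscInt (component (uncurryField f) (y', z') j)))) :=
  hasSum_oscTerm_mulVec_neg Ω (fun i _ => contDiff_entry hF (x, y) i _)
    (contDiff_component (hF.of_le (by norm_num)) (y', z')) (periodic_component hFp (y', z'))
    (fun k i j => jacY_apply (hF.of_le (by norm_num)) hd k x y i j)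
    (fun k j => fourierCo_apply hF.continuous k y' z' j)

theorem seriesConverge (hF : ContDiff ℝ 2 (uncurryField f))
    (hFp : PeriodicInAngle (uncurryField f))
    (hd : ∀ θ, Differentiable 𝕜 fun p => uncurryField f (p, θ)) (Ω : ℝ)
    (x y z v : Fin D → 𝕜) : SeriesConverge f Ω x y z v :=
  ⟨(hasSum_mulVec_fourierCo hF hFp Ω x y _).summable,
    (hasSum_jacX_mulVec_const hF hFp hd Ω x y _).summable,
    (hasSum_jacX_mulVec_neg hF hFp hd Ω x y x y).summable,
    (hasSum_jacY_mulVec_const hF hFp hd Ω x y _).summable,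
    (hasSum_mulVec_fourierCo hF hFp Ω y z _).summable,
    (hasSum_jacY_mulVec_const hF hFp hd Ω x y _).summable,
    (hasSum_jacY_mulVec_neg hF hFp hd Ω x y y z).summable⟩

/-- Parseval's formula splits the mean of ∂ₓF·u into the term with ∂ₓf₀ and the one with f₋ₖ. Since
b = 0, the y-derivative contributes only through the velocity v. -/
theorem F21_eq (hF : ContDiff ℝ 2 (uncurryField f))
    (hFp : PeriodicInAngle (uncurryField f))
    (hd : ∀ θ, Differentiable 𝕜 fun p => uncurryField f (p, θ)) (Ω : ℝ) (x y v : Fin D → 𝕜) :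
    F21 f Ω x y v = toC (avgField₁ (uncurryField f) Ω ((x, y), v)) := by
  have hF1 : ContDiff ℝ 1 (uncurryField f) := hF.of_le (by norm_num)
  funext i
  have hu : Continuous fun θ => oscPrim (uncurryField f) ((x, y), θ) :=
    (contDiff_oscPrim hF1).continuous.comp (Continuous.prodMk_right (x, y))
  have hres : toC (avg (residual (uncurryField f) Prod.fst (fun _ => 0) Prod.snd) ((x, y), v)) i
      = _ := coordC_periodMean_residual hF hd (x, y) i hu continuous_const
        (avg (uncurryField f) (x, y)) v (b := fun _ => 0)
  have hsplit : toC (avgField₁ (uncurryField f) Ω ((x, y), v)) i = fourierCo f 0 x y i + (Ω : ℂ)⁻¹ *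
      toC (avg (residual (uncurryField f) Prod.fst (fun _ => 0) Prod.snd) ((x, y), v)) i := by
    rw [← toC_avg hF.continuous, avgField₁, ← coordC_apply, map_add, map_smul, Complex.real_smul,
      Complex.ofReal_inv]
    rfl
  have h0 : ∀ j, periodMean (fun θ => entryY (uncurryField f) (x, y) i j θ
      * toC (0 : Fin D → 𝕜) j) = 0 := fun j => by simp [toC, periodMean]
  rw [hsplit, hres, F21, oscSum, oscSum, oscSum, oscSum,
    (hasSum_mulVec_fourierCo hF hFp Ω x y _).tsum_eq,
    (hasSum_jacX_mulVec_const hF hFp hd Ω x y _).tsum_eq,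
    (hasSum_jacX_mulVec_neg hF hFp hd Ω x y x y).tsum_eq,
    (hasSum_jacY_mulVec_const hF hFp hd Ω x y _).tsum_eq]
  simp only [Pi.add_apply, Pi.sub_apply, h0, toC_oscPrim hF.continuous, toC_avg hF.continuous,
    Finset.sum_add_distrib, Finset.sum_sub_distrib, Finset.sum_const_zero]
  ring

theorem F22_eq (hF : ContDiff ℝ 2 (uncurryField f))
    (hFp : PeriodicInAngle (uncurryField f))
    (hd : ∀ θ, Differentiable 𝕜 fun p => uncurryField f (p, θ)) (Ω : ℝ) (x y z : Fin D → 𝕜) :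
    F22 f Ω x y z = toC (avgField₂ (uncurryField f) Ω ((x, y), z)) := by
  have hF1 : ContDiff ℝ 1 (uncurryField f) := hF.of_le (by norm_num)
  funext i
  have hu : ∀ q, Continuous fun θ => oscPrim (uncurryField f) (q, θ) := fun q =>
    (contDiff_oscPrim hF1).continuous.comp (Continuous.prodMk_right q)
  have hres : toC (avg (residual (uncurryField f) Prod.fst
      (fun q => oscPrim (uncurryField f) ((q.1.1.2, q.1.2), q.2))
      (fun s => avg (uncurryField f) (s.1.2, s.2))) ((x, y), z)) i
      = _ := coordC_periodMean_residual hF hd (x, y) i (hu (x, y)) (hu (y, z))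
        (avg (uncurryField f) (x, y)) (avg (uncurryField f) (y, z))
  have hsplit : toC (avgField₂ (uncurryField f) Ω ((x, y), z)) i = fourierCo f 0 x y i + (Ω : ℂ)⁻¹ *
      toC (avg (residual (uncurryField f) Prod.fst
      (fun q => oscPrim (uncurryField f) ((q.1.1.2, q.1.2), q.2))
      (fun s => avg (uncurryField f) (s.1.2, s.2))) ((x, y), z)) i := by
    rw [← toC_avg hF.continuous, avgField₂, ← coordC_apply, map_add, map_smul, Complex.real_smul,
      Complex.ofReal_inv]
    rfl
  rw [hsplit, hres, F22, oscSum, oscSum, oscSum, oscSum, oscSum, oscSum,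
    (hasSum_mulVec_fourierCo hF hFp Ω x y _).tsum_eq,
    (hasSum_jacX_mulVec_const hF hFp hd Ω x y _).tsum_eq,
    (hasSum_jacX_mulVec_neg hF hFp hd Ω x y x y).tsum_eq,
    (hasSum_mulVec_fourierCo hF hFp Ω y z _).tsum_eq,
    (hasSum_jacY_mulVec_const hF hFp hd Ω x y _).tsum_eq,
    (hasSum_jacY_mulVec_neg hF hFp hd Ω x y y z).tsum_eq]
  simp only [Pi.add_apply, Pi.sub_apply, toC_oscPrim hF.continuous, toC_avg hF.continuous,
    Finset.sum_add_distrib, Finset.sum_sub_distrib]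
  ring

/-- The averaged equation is posed in ℂ^D; a linear left inverse of the injective map `toC` brings
it back to 𝕜^D. -/
theorem hasDerivWithinAt_of_toC {X : ℝ → Fin D → 𝕜} {d : Fin D → 𝕜} {s : Set ℝ} {t : ℝ}
    (h : HasDerivWithinAt (fun r => toC (X r)) (toC d) s t) : HasDerivWithinAt X d s t := by
  have hinj : LinearMap.ker (toCL 𝕜 D : (Fin D → 𝕜) →ₗ[ℝ] (Fin D → ℂ)) = ⊥ := by
    refine LinearMap.ker_eq_bot.2 fun v w hvw => funext fun i => ?_
    exact (algebraMap 𝕜 ℂ).injective (congrFun hvw i)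
  obtain ⟨g, hg⟩ := LinearMap.exists_leftInverse_of_injective _ hinj
  have hg' : ∀ v : Fin D → 𝕜, g.toContinuousLinearMap (toC v) = v := fun v => LinearMap.congr_fun hg v
  have h1 := (g.toContinuousLinearMap.hasFDerivAt (x := toC (X t))).comp_hasDerivWithinAt t h
  rw [hg'] at h1
  exact h1.congr (fun r _ => (hg' (X r)).symm) (hg' (X t)).symm

end AveragedEquation

/-! ### Passage to right derivatives and the main theorem -/

section Main

variable {𝕜 : Type*} [RCLike 𝕜] [NormedAlgebra 𝕜 ℂ] {D : ℕ}
  {f : (Fin D → 𝕜) → (Fin D → 𝕜) → ℝ → (Fin D → 𝕜)} {φ : ℝ → (Fin D → 𝕜)}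

theorem isSolutionPair_of_solutions (hF : ContDiff ℝ 2 (uncurryField f))
    (hFp : PeriodicInAngle (uncurryField f))
    (hd : ∀ θ, Differentiable 𝕜 fun p => uncurryField f (p, θ)) {τ Ω T : ℝ} (hτ : 0 < τ)
    (hφ : ContinuousOn φ (Icc (-τ) 0)) (hT : 0 ≤ T) {x X : ℝ → (Fin D → 𝕜)}
    (hx : IsOscSolution f φ τ Ω T x) (hX : IsAvgSolution f φ τ Ω T X) :
    IsSolutionPair (uncurryField f) φ (derivWithin φ (Icc (-τ) 0)) τ Ω T x X where
  history := hx.history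
  history_avg := hX.history
  continuousOn := by
    rw [← Icc_union_Icc_eq_Icc (show -τ ≤ 0 by linarith) hT]
    exact (hφ.congr hx.history).union_of_isClosed
      (fun t ht => (hx.eqn t ht).continuousWithinAt) isClosed_Icc isClosed_Icc
  continuousOn_avg := hX.continuousOn
  eqn t ht := (hx.eqn t ⟨ht.1, ht.2.le⟩).mono_of_mem_nhdsWithin
    (mem_of_superset (Icc_mem_nhdsGE ht.2) (Icc_subset_Icc_left ht.1))
  eqn_avg₁ t ht htτ := by
    have h := hX.eqn₁ t ⟨ht.1, ht.2.le⟩ htτ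
    rw [F21_eq hF hFp hd] at h
    exact (hasDerivWithinAt_of_toC h).mono_of_mem_nhdsWithin
      (mem_of_superset (Icc_mem_nhdsGE ht.2) (Icc_subset_Icc_left ht.1))
  eqn_avg₂ t ht htτ := by
    have h := hX.eqn₂ t ⟨htτ, ht.2.le⟩
    rw [F22_eq hF hFp hd] at h
    exact (hasDerivWithinAt_of_toC h).mono_of_mem_nhdsWithin
      (mem_of_superset (Icc_mem_nhdsGE ht.2) (Icc_subset_Icc_left htτ))

end Main

end

end DelayAveraging

open DelayAveraging in
theorem mainTheorem2 {𝕜 : Type*} [RCLike 𝕜] [NormedAlgebra 𝕜 ℂ] (D : ℕ)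
    (f : (Fin D → 𝕜) → (Fin D → 𝕜) → ℝ → (Fin D → 𝕜))
    (hf_smooth : ContDiff ℝ ∞
      (fun p : (Fin D → 𝕜) × (Fin D → 𝕜) × ℝ => f p.1 p.2.1 p.2.2))
    (hf_diff : ∀ θ : ℝ, Differentiable 𝕜
      (fun p : (Fin D → 𝕜) × (Fin D → 𝕜) => f p.1 p.2 θ))
    (hf_periodic : ∀ x y, Function.Periodic (f x y) (2 * Real.pi))
    (τ : ℝ) (hτ : 0 < τ)
    (φ : ℝ → (Fin D → 𝕜)) (hφ : ContDiffOn ℝ ∞ φ (Set.Icc (-τ) 0)) :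
    (∀ Ω : ℝ, 0 < Ω → ∀ x y z v : Fin D → 𝕜,
      DelayAveraging.SeriesConverge f Ω x y z v) ∧
    ∀ T R : ℝ, 0 ≤ T → ∃ C Ω₀ : ℝ, 0 < Ω₀ ∧
      ∀ Ω : ℝ, Ω₀ ≤ Ω → (∃ n : ℕ, τ = n * (2 * Real.pi / Ω)) →
      ∀ x X : ℝ → (Fin D → 𝕜),
        DelayAveraging.IsOscSolution f φ τ Ω T x →
        DelayAveraging.IsAvgSolution f φ τ Ω T X →
        ((∀ t ∈ Set.Icc 0 T, ‖x t‖ ≤ R) ∨ (∀ t ∈ Set.Icc 0 T, ‖X t‖ ≤ R)) →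
        ∀ m : ℕ, m * (2 * Real.pi / Ω) ≤ T →
          ‖x (m * (2 * Real.pi / Ω)) - X (m * (2 * Real.pi / Ω))‖ ≤ C / Ω ^ 2 := by
  have hF : ContDiff ℝ 2 (uncurryField f) := by
    have h : ContDiff ℝ ∞ fun q : ((Fin D → 𝕜) × (Fin D → 𝕜)) × ℝ =>
        ((q.1.1, q.1.2, q.2) : (Fin D → 𝕜) × (Fin D → 𝕜) × ℝ) := by fun_prop
    exact contDiff_infty.1 (hf_smooth.comp h) 2
  have hFp : PeriodicInAngle (uncurryField f) := fun p => hf_periodic p.1 p.2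
  have hd : ∀ θ, Differentiable 𝕜 fun p => uncurryField f (p, θ) := hf_diff
  refine ⟨fun Ω _ x y z v => seriesConverge hF hFp hd Ω x y z v, fun T R hT => ?_⟩
  have hu : UniqueDiffOn ℝ (Icc (-τ) 0) := uniqueDiffOn_Icc (by linarith)
  have hφ' : ContDiffOn ℝ ∞ (derivWithin φ (Icc (-τ) 0)) (Icc (-τ) 0) :=
    hφ.derivWithin hu (by simp)
  -- A bound on the second derivative of the history is the Lipschitz constant required of φ'.
  have hφ'' : ContDiffOn ℝ ∞ (derivWithin (derivWithin φ (Icc (-τ) 0)) (Icc (-τ) 0))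
      (Icc (-τ) 0) := hφ'.derivWithin hu (by simp)
  obtain ⟨B₀, hB₀⟩ := isCompact_Icc.exists_bound_of_continuousOn hφ.continuousOn
  obtain ⟨B₁, hB₁⟩ := isCompact_Icc.exists_bound_of_continuousOn hφ'.continuousOn
  obtain ⟨B₂, hB₂⟩ := isCompact_Icc.exists_bound_of_continuousOn hφ''.continuousOn
  have hB₂0 : 0 ≤ B₂ := (norm_nonneg _).trans (hB₂ 0 ⟨by linarith, le_rfl⟩)
  have hlip : ∀ s ∈ Icc (-τ) 0, ∀ t ∈ Icc (-τ) 0, s ≤ t →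
      ‖derivWithin φ (Icc (-τ) 0) t - derivWithin φ (Icc (-τ) 0) s‖ ≤ B₂ * (t - s) := by
    intro s hs t ht hst
    have := (convex_Icc (-τ) 0).norm_image_sub_le_of_norm_derivWithin_le
      (hφ'.differentiableOn (by simp)) hB₂ hs ht
    rwa [Real.norm_of_nonneg (by linarith)] at this
  have hright : ∀ t ∈ Ico (-τ) 0,
      HasDerivWithinAt φ (derivWithin φ (Icc (-τ) 0) t) (Ici t) t := fun t ht =>
    ((hφ.differentiableOn (by simp) t ⟨ht.1, ht.2.le⟩).hasDerivWithinAt).mono_of_mem_nhdsWithin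
      (Filter.mem_of_superset (Icc_mem_nhdsGE ht.2) (Icc_subset_Icc_left ht.1))
  obtain ⟨C, Ω₀, hΩ₀, h⟩ := exists_stroboscopic_error_bound hF hFp hτ hright hB₂0 hB₀ hB₁ hlip hT R
  exact ⟨C, Ω₀, hΩ₀, fun Ω hΩ hn x X hx hX => h Ω hΩ hn x X
    (isSolutionPair_of_solutions hF hFp hd hτ hφ.continuousOn hT hx hX)⟩
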